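/- Let $k,d$ be integers with $1\le d<k$. Let $X_k=SL_k(\mathbb R)/SL_k(\mathbb Z)$, identified with the space of unimodular lattices in $\mathbb R^k$ via $g\,SL_k(\mathbb Z)\mapsto g\mathbb Z^k$, and let $\mu$ be the normalized Haar measure on $X_k$, i.e. the Borel probability measure on $X_k$ invariant under the left action of $SL_k(\mathbb R)$ (such a measure exists). For a lattice $\Lambda\subset\mathbb R^k$, let $P^d(\Lambda)$ be the set of primitive ordered $d$-tuples of $\Lambda$, i.e. of those $(v_1,\dots,v_d)\in\Lambda^d$ that can be extended to a $\mathbb Z$-basis of $\Lambda$. Then for every complex-valued $\varphi\in L^1(\mathbb R^{kd})$ the series $$\widehat\varphi^{\,d}(\Lambda)=\sum_{(v_1,\dots,v_d)\in P^d(\Lambda)}\varphi(v_1,\dots,v_d)$$ converges absolutely for $\mu$-almost every $\Lambda\in X_k$, the function $\widehat\varphi^{\,d}$ is $\mu$-integrable, and $$\int_{X_k}\widehat\varphi^{\,d}\,d\mu=c_{k,d}\int_{\mathbb R^{kd}}\varphi\,dv_1\cdots dv_d,\qquad c_{k,d}=\frac1{\zeta(k)\,\zeta(k-1)\cdots\zeta(k-d+1)},$$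 where $\zeta$ is the Riemann zeta function. -/

import Mathlib

open MeasureTheory
open scoped MatrixGroups

noncomputable section

/-- `SL_k(ℤ)` as a subgroup of `SL_k(ℝ)`. -/
def integerSL (k : ℕ) : Subgroup SL(k, ℝ) :=
  (Matrix.SpecialLinearGroup.map (n := Fin k) (Int.castRingHom ℝ)).range

/-- The space `X_k = SL_k(ℝ) / SL_k(ℤ)` of left cosets, with its quotient topology and with
`SL_k(ℝ)` acting by left translation. -/
abbrev LatticeSpace (k : ℕ) : Type := SL(k, ℝ) ⧸ integerSL k

/-- `X_k` carries its Borel σ-algebra. -/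
instance instMeasurableSpaceLatticeSpace (k : ℕ) : MeasurableSpace (LatticeSpace k) :=
  borel (LatticeSpace k)

instance instBorelSpaceLatticeSpace (k : ℕ) : BorelSpace (LatticeSpace k) := ⟨rfl⟩

/-- The normalized Haar measure on `X_k`: a Borel probability measure that is invariant under the
left action of `SL_k(ℝ)`. -/
structure IsNormalizedHaar {k : ℕ} (μ : Measure (LatticeSpace k)) : Prop where
  isProbabilityMeasure : IsProbabilityMeasure μ
  smulInvariant : SMulInvariantMeasure SL(k, ℝ) (LatticeSpace k) μ

/-- The lattice `g ℤ^k ⊆ ℝ^k`: the integer span of the columns of `g`. -/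
def matrixLattice {k : ℕ} (g : SL(k, ℝ)) : Submodule ℤ (Fin k → ℝ) :=
  Submodule.span ℤ (Set.range (g : Matrix (Fin k) (Fin k) ℝ).col)

theorem matrixLattice_mul_le {k : ℕ} (g h : SL(k, ℝ)) (hh : h ∈ integerSL k) :
    matrixLattice (g * h) ≤ matrixLattice g := by
  obtain ⟨c, rfl⟩ := hh
  refine Submodule.span_le.2 ?_
  rintro _ ⟨j, rfl⟩
  have key : (↑(g * Matrix.SpecialLinearGroup.map (Int.castRingHom ℝ) c) :
      Matrix (Fin k) (Fin k) ℝ).col j =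
      ∑ i, (c : Matrix (Fin k) (Fin k) ℤ) i j • (g : Matrix (Fin k) (Fin k) ℝ).col i := by
    ext l
    simp [Matrix.col_apply, Matrix.mul_apply, Finset.sum_apply, mul_comm]
  rw [key]
  exact Submodule.sum_mem _ fun i _ =>
    Submodule.smul_mem _ _ (Submodule.subset_span ⟨i, rfl⟩)

theorem matrixLattice_eq_of_leftRel {k : ℕ} (g h : SL(k, ℝ))
    (hgh : QuotientGroup.leftRel (integerSL k) g h) : matrixLattice g = matrixLattice h := by
  rw [QuotientGroup.leftRel_apply] at hgh
  apply le_antisymm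
  · simpa using matrixLattice_mul_le h (g⁻¹ * h)⁻¹ (inv_mem hgh)
  · simpa using matrixLattice_mul_le g (g⁻¹ * h) hgh

/-- The unimodular lattice `g ℤ^k` represented by the coset `g SL_k(ℤ)`. -/
def LatticeSpace.lattice {k : ℕ} (x : LatticeSpace k) : Submodule ℤ (Fin k → ℝ) :=
  Quotient.lift matrixLattice matrixLattice_eq_of_leftRel x

/-- The set `P^d(Λ)` of ordered `d`-tuples of vectors of `Λ` that extend to a `ℤ`-basis of `Λ`
(a lattice in `ℝ^k`, so of rank `k`). -/
def primitiveTuples {k : ℕ} (d : ℕ) (L : Submodule ℤ (Fin k → ℝ)) : Set (Fin d → Fin k → ℝ) :=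
  {v | ∃ (b : Module.Basis (Fin k) ℤ L) (e : Fin d ↪ Fin k), ∀ i, (b (e i) : Fin k → ℝ) = v i}

/-- The sum of `φ` over the primitive `d`-tuples of the lattice `x`. -/
def primitiveSum {k d : ℕ} (φ : (Fin d → Fin k → ℝ) → ℂ) (x : LatticeSpace k) : ℂ :=
  ∑' v : primitiveTuples d x.lattice, φ v

end

/-!
Write `k = d + e + 1`. The group `SL_k(ℤ)` acts transitively on the integral primitive `d`-tuples,
so the sum over the primitive tuples of `g ℤ^k` can be unfolded: its integral over `X_k` becomes an
integral over `SL_k(ℝ)` modulo the integral stabilizer of the first `d` standard basis vectors. In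
coordinates where the columns of a matrix are the variables this integral is `∫ φ` times the
covolume of `SL_{e+1}(ℤ)`, whence `∫ φ̂ dμ = c ∫ φ` with
`c = covol SL_{e+1}(ℤ) / covol SL_k(ℤ)`.

By Minkowski's theorem every unimodular lattice has a primitive vector in the unit ball of the sup
norm, so for `d = 1` the formula with the indicator function of that ball shows inductively that the
covolumes are finite; in particular `μ` exists. Every nonzero lattice vector is a unique positive
multiple of a primitive one, so the mean number of nonzero lattice points in a ball is
`c ζ(k)` times its volume; comparing with the number of points of a single unimodular lattice in a
large ball gives `c ζ(k) = 1` for `d = 1`. These ratios of covolumes multiply to `c` in general.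

Fundamental domains are replaced by weights, positive functions whose sum over each coset is one.
-/

noncomputable section

open MeasureTheory Matrix Set Module
open scoped MatrixGroups ENNReal

section Weights

variable {G Γ : Type*} [Group G] [Group Γ] {ρ : Γ →* G} {w w' : G → ℝ≥0∞}

/-- A positive measurable function on `G` whose sum over each left coset of the image of `ρ` is
one. It plays the role of the indicator function of a fundamental domain for `G / Γ`. -/
structure IsWeight [MeasurableSpace G] (ρ : Γ →* G) (w : G → ℝ≥0∞) : Prop where
  measurable : Measurable w
  pos : ∀ g, 0 < w g
  tsum_eq_one : ∀ g, ∑' γ, w (g * ρ γ) = 1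

theorem le_tsum_mul_right (ρ : Γ →* G) (f : G → ℝ≥0∞) (g : G) : f g ≤ ∑' γ, f (g * ρ γ) := by
  simpa only [map_one, mul_one] using ENNReal.le_tsum (f := fun γ => f (g * ρ γ)) 1

theorem tsum_mul_right_mul (ρ : Γ →* G) (f : G → ℝ≥0∞) (g : G) (γ₀ : Γ) :
    ∑' γ, f (g * ρ γ₀ * ρ γ) = ∑' γ, f (g * ρ γ) := by
  rw [← (Equiv.mulLeft γ₀).tsum_eq fun γ => f (g * ρ γ)]
  simp only [Equiv.coe_mulLeft, map_mul, mul_assoc]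

theorem tsum_indicator_mul_right_le_one {V : Set G}
    (hV : ∀ γ, ∀ a ∈ V, a * ρ γ ∈ V → γ = 1) (g : G) :
    ∑' γ, V.indicator (1 : G → ℝ≥0∞) (g * ρ γ) ≤ 1 := by
  by_cases h : ∃ γ₀, g * ρ γ₀ ∈ V
  · obtain ⟨γ₀, h₀⟩ := h
    rw [tsum_eq_single γ₀, indicator_of_mem h₀, Pi.one_apply]
    refine fun γ hγ => indicator_of_notMem (fun hmem => hγ ?_) _
    have hV₀ := hV (γ₀⁻¹ * γ) _ h₀ (by rwa [mul_assoc, ← map_mul, mul_inv_cancel_left])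
    exact (inv_mul_eq_one.1 hV₀).symm
  · push Not at h
    simp [indicator_of_notMem (h _)]

section Measurable

variable [MeasurableSpace G]

theorem isWeight_div_tsum [MeasurableMul G] [Countable Γ] {u : G → ℝ≥0∞} (hu : Measurable u)
    (hpos : ∀ g, 0 < u g) (htop : ∀ g, ∑' γ, u (g * ρ γ) ≠ ∞) :
    IsWeight ρ fun g => u g / ∑' γ, u (g * ρ γ) where
  measurable := hu.div (Measurable.tsum fun γ => hu.comp (measurable_mul_const _))
  pos g := ENNReal.div_pos (hpos g).ne' (htop g)
  tsum_eq_one g := by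
    simp only [tsum_mul_right_mul, div_eq_mul_inv, ENNReal.tsum_mul_right]
    exact ENNReal.mul_inv_cancel ((hpos g).trans_le (le_tsum_mul_right ρ u g)).ne' (htop g)

theorem IsWeight.le_one (hw : IsWeight ρ w) (g : G) : w g ≤ 1 :=
  (le_tsum_mul_right ρ w g).trans (hw.tsum_eq_one g).le

theorem IsWeight.comp_mulEquiv {G' Γ' : Type*} [Group G'] [Group Γ'] [MeasurableSpace G']
    {ρ' : Γ' →* G'} (hw : IsWeight ρ w) {e : G' ≃* G} (he : Measurable e) (e' : Γ' ≃* Γ)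
    (hcomm : ∀ γ, e (ρ' γ) = ρ (e' γ)) : IsWeight ρ' (w ∘ e) where
  measurable := hw.measurable.comp he
  pos g := hw.pos (e g)
  tsum_eq_one g := by
    rw [← hw.tsum_eq_one (e g), ← e'.toEquiv.tsum_eq]
    simp [hcomm]

variable [MeasurableMul G] [Countable Γ] {m : Measure G} [m.IsMulRightInvariant]

theorem IsWeight.lintegral_mul_tsum (hw : IsWeight ρ w) {F : G → ℝ≥0∞} (hF : Measurable F) :
    ∫⁻ g, w g * ∑' γ, F (g * ρ γ) ∂m = ∫⁻ g, F g ∂m := by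
  calc ∫⁻ g, w g * ∑' γ, F (g * ρ γ) ∂m
      = ∑' γ, ∫⁻ g, w g * F (g * ρ γ) ∂m := by
        simp only [← ENNReal.tsum_mul_left]
        exact lintegral_tsum fun γ =>
          (hw.measurable.mul (hF.comp (measurable_mul_const _))).aemeasurable
    _ = ∑' γ, ∫⁻ g, w (g * ρ γ⁻¹) * F g ∂m := by
        refine tsum_congr fun γ => ?_
        rw [← lintegral_mul_right_eq_self (fun g => w (g * ρ γ⁻¹) * F g) (ρ γ)]
        simp [mul_assoc]
    _ = ∫⁻ g, (∑' γ, w (g * ρ γ⁻¹)) * F g ∂m := by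
        simp only [← ENNReal.tsum_mul_right]
        exact (lintegral_tsum fun γ =>
          ((hw.measurable.comp (measurable_mul_const _)).mul hF).aemeasurable).symm
    _ = ∫⁻ g, F g ∂m := by
        refine lintegral_congr fun g => ?_
        rw [← (Equiv.inv Γ).tsum_eq]
        simp only [Equiv.inv_apply, inv_inv, hw.tsum_eq_one, one_mul]

theorem IsWeight.lintegral_mul_eq_lintegral_mul (hw : IsWeight ρ w) (hw' : IsWeight ρ w')
    {H : G → ℝ≥0∞} (hH : Measurable H) (hinv : ∀ g γ, H (g * ρ γ) = H g) :
    ∫⁻ g, w g * H g ∂m = ∫⁻ g, w' g * H g ∂m := by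
  rw [← hw.lintegral_mul_tsum (F := fun g => w' g * H g) (hw'.measurable.mul hH)]
  refine lintegral_congr fun g => ?_
  simp only [hinv, ENNReal.tsum_mul_right, hw'.tsum_eq_one, one_mul]

end Measurable

section Existence

variable [TopologicalSpace G] [IsTopologicalGroup G]

theorem exists_isOpen_forall_mul_mem_imp_eq_one
    (hρ : ∀ᶠ g in nhds (1 : G), ∀ γ, ρ γ = g → γ = 1) :
    ∃ V : Set G, IsOpen V ∧ 1 ∈ V ∧ ∀ γ, ∀ a ∈ V, a * ρ γ ∈ V → γ = 1 := by
  have hdiv : Filter.Tendsto (fun p : G × G => p.1⁻¹ * p.2) (nhds 1 ×ˢ nhds 1) (nhds 1) := by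
    rw [← nhds_prod_eq]
    exact Continuous.tendsto' (by fun_prop) _ _ (by simp)
  obtain ⟨U, hU, hUρ⟩ := Filter.mem_prod_same_iff.1 (hdiv.eventually hρ)
  refine ⟨interior U, isOpen_interior, mem_interior_iff_mem_nhds.2 hU, fun γ a ha hb => ?_⟩
  exact hUρ (mk_mem_prod (interior_subset ha) (interior_subset hb)) γ (inv_mul_cancel_left a _).symm

theorem exists_isWeight [TopologicalSpace.SeparableSpace G] [MeasurableSpace G] [BorelSpace G]
    [Countable Γ] (hρ : ∀ᶠ g in nhds (1 : G), ∀ γ, ρ γ = g → γ = 1) : ∃ w, IsWeight ρ w := by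
  obtain ⟨V, hVo, hV1, hV⟩ := exists_isOpen_forall_mul_mem_imp_eq_one hρ
  let x := TopologicalSpace.denseSeq G
  let u : G → ℝ≥0∞ := fun g => ∑' i : ℕ, (2 : ℝ≥0∞)⁻¹ ^ i * V.indicator 1 ((x i)⁻¹ * g)
  have hu : Measurable u := Measurable.tsum fun i =>
    ((measurable_one.indicator hVo.measurableSet).comp (measurable_const_mul _)).const_mul _
  have hpos : ∀ g, 0 < u g := by
    intro g
    have hopen : IsOpen {y : G | y⁻¹ * g ∈ V} := hVo.preimage (by fun_prop)
    obtain ⟨i, hi⟩ := (TopologicalSpace.denseRange_denseSeq G).exists_mem_open hopen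
      ⟨g, by simpa using hV1⟩
    refine lt_of_lt_of_le ?_ (ENNReal.le_tsum i)
    rw [indicator_of_mem (show (x i)⁻¹ * g ∈ V from hi), Pi.one_apply, mul_one]
    exact ENNReal.pow_pos (by simp) i
  have hsum : ∀ g, ∑' γ, u (g * ρ γ) ≤ 2 := fun g => by
    calc ∑' γ, u (g * ρ γ)
        = ∑' i : ℕ, (2 : ℝ≥0∞)⁻¹ ^ i * ∑' γ, V.indicator 1 ((x i)⁻¹ * g * ρ γ) := by
          simp only [u, ENNReal.tsum_comm (α := Γ), ENNReal.tsum_mul_left, mul_assoc]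
      _ ≤ ∑' i : ℕ, (2 : ℝ≥0∞)⁻¹ ^ i := ENNReal.tsum_le_tsum fun i =>
          mul_le_of_le_one_right' (tsum_indicator_mul_right_le_one hV _)
      _ = 2 := by rw [ENNReal.tsum_geometric]; simp
  exact ⟨_, isWeight_div_tsum hu hpos fun g => ne_top_of_le_ne_top (by simp) (hsum g)⟩

end Existence

end Weights

section Uniqueness

theorem exists_eq_smul_of_isMulLeftInvariant {G : Type*} [MeasurableSpace G] [Group G]
    [MeasurableMul₂ G] [MeasurableInv G] {m m' : Measure G} [SigmaFinite m] [SigmaFinite m']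
    [m.IsMulLeftInvariant] [m'.IsMulLeftInvariant] (hm : m ≠ 0) :
    ∃ c : ℝ≥0∞, m' = c • m := by
  obtain ⟨i, hi⟩ := (Measure.exists_measure_inter_spanningSets_pos univ).2
    (Measure.measure_univ_pos.2 hm)
  rw [univ_inter] at hi
  exact ⟨_, measure_eq_div_smul m' m hi.ne' (measure_spanningSets_lt_top m i).ne⟩

end Uniqueness

section Matrices

theorem measurePreserving_of_involutive {E : Type*} [NormedAddCommGroup E] [NormedSpace ℝ E]
    [MeasurableSpace E] [BorelSpace E] [FiniteDimensional ℝ E] (μ : Measure E)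
    [μ.IsAddHaarMeasure] {T : E →ₗ[ℝ] E} (hT : T ∘ₗ T = LinearMap.id) :
    MeasurePreserving T μ μ := by
  have hdet : LinearMap.det T * LinearMap.det T = 1 := by
    rw [← LinearMap.det_comp, hT, LinearMap.det_id]
  have habs : |(LinearMap.det T)⁻¹| = 1 := by
    rcases mul_self_eq_one_iff.1 hdet with h | h <;> simp [h]
  refine ⟨T.continuous_of_finiteDimensional.measurable, ?_⟩
  rw [Measure.map_linearMap_addHaar_eq_smul_addHaar μ (left_ne_zero_of_mul_eq_one hdet), habs,
    ENNReal.ofReal_one, one_smul]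

theorem volume_preserving_transpose {n : Type*} [Fintype n] :
    MeasurePreserving (fun (A : n → n → ℝ) i j => A j i) volume volume :=
  measurePreserving_of_involutive volume
    (T := (⟨⟨fun A i j => A j i, fun _ _ => rfl⟩, fun _ _ => rfl⟩ :
      (n → n → ℝ) →ₗ[ℝ] n → n → ℝ)) rfl

/-- The matrix whose columns are the given vectors. -/
def colMat {n : Type*} (A : n → n → ℝ) : Matrix n n ℝ := (Matrix.of A)ᵀ

@[simp] theorem colMat_apply {n : Type*} (A : n → n → ℝ) (i j : n) : colMat A i j = A j i := rfl

/-- Left multiplication of a tuple of columns by a matrix. -/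
def mulCols {ι n : Type*} [Fintype n] (g : Matrix n n ℝ) (A : ι → n → ℝ) : ι → n → ℝ :=
  fun j => g *ᵥ A j

/-- Right multiplication by `g` of the matrix with columns `A`. -/
def rightMul {n : Type*} [Fintype n] (g : Matrix n n ℝ) (A : n → n → ℝ) : n → n → ℝ :=
  (colMat A * g)ᵀ

theorem colMat_mulCols {n : Type*} [Fintype n] (g : Matrix n n ℝ) (A : n → n → ℝ) :
    colMat (mulCols g A) = g * colMat A := rfl

theorem colMat_rightMul {n : Type*} [Fintype n] (g : Matrix n n ℝ) (A : n → n → ℝ) :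
    colMat (rightMul g A) = colMat A * g := rfl

end Matrices

section SpecialLinearGroup

variable {n : Type*} [Fintype n] [DecidableEq n]

instance instMeasurableSpaceSL : MeasurableSpace (SpecialLinearGroup n ℝ) := borel _

instance instBorelSpaceSL : BorelSpace (SpecialLinearGroup n ℝ) := ⟨rfl⟩

instance instPolishSpaceSL : PolishSpace (SpecialLinearGroup n ℝ) :=
  haveI : PolishSpace (Matrix n n ℝ) := inferInstanceAs (PolishSpace (n → n → ℝ))
  IsClosed.polishSpace (isClosed_singleton.preimage (continuous_id.matrix_det) :
    IsClosed {A : Matrix n n ℝ | A.det = 1})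

instance instCountableSLInt : Countable (SpecialLinearGroup n ℤ) :=
  haveI : Countable (Matrix n n ℤ) := inferInstanceAs (Countable (n → n → ℤ))
  inferInstanceAs (Countable {A : Matrix n n ℤ // A.det = 1})

theorem measurable_sl_iff {α : Type*} [MeasurableSpace α] {f : α → SpecialLinearGroup n ℝ} :
    Measurable f ↔ ∀ i j, Measurable fun a => (f a : Matrix n n ℝ) i j := by
  have hcomap : (instMeasurableSpaceSL : MeasurableSpace (SpecialLinearGroup n ℝ)) =
      MeasurableSpace.comap (fun (g : SpecialLinearGroup n ℝ) i j => (g : Matrix n n ℝ) i j)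
        MeasurableSpace.pi := by
    rw [show (MeasurableSpace.pi : MeasurableSpace (n → n → ℝ)) = borel _ from
      BorelSpace.measurable_eq]
    exact borel_comap
  rw [hcomap, measurable_comap_iff, measurable_pi_iff]
  simp only [measurable_pi_iff]
  rfl

theorem continuous_sl_apply (i j : n) :
    Continuous fun g : SpecialLinearGroup n ℝ => (g : Matrix n n ℝ) i j :=
  (continuous_apply_apply i j).comp continuous_subtype_val

theorem measurable_sl_apply (i j : n) :
    Measurable fun g : SpecialLinearGroup n ℝ => (g : Matrix n n ℝ) i j :=
  (continuous_sl_apply i j).measurable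

theorem continuous_det_colMat : Continuous fun A : n → n → ℝ => (colMat A).det :=
  Continuous.matrix_det
    (continuous_pi fun i => continuous_pi fun j => by simp only [colMat_apply]; fun_prop)

theorem measurable_det_colMat : Measurable fun A : n → n → ℝ => (colMat A).det :=
  continuous_det_colMat.measurable

theorem volume_preserving_mulVec (g : SpecialLinearGroup n ℝ) :
    MeasurePreserving (fun v : n → ℝ => (g : Matrix n n ℝ) *ᵥ v) volume volume := by
  refine ⟨by fun_prop, ?_⟩
  have h := Real.map_matrix_volume_pi_eq_smul_volume_pi (M := (g : Matrix n n ℝ)) (by simp)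
  rwa [Matrix.SpecialLinearGroup.det_coe, inv_one, abs_one, ENNReal.ofReal_one, one_smul] at h

theorem volume_preserving_mulCols {ι : Type*} [Fintype ι] (g : SpecialLinearGroup n ℝ) :
    MeasurePreserving (mulCols (ι := ι) (g : Matrix n n ℝ)) volume volume :=
  volume_preserving_pi fun _ => volume_preserving_mulVec g

theorem volume_preserving_rightMul (g : SpecialLinearGroup n ℝ) :
    MeasurePreserving (rightMul (g : Matrix n n ℝ)) volume volume := by
  have h := volume_preserving_transpose.comp
    ((volume_preserving_mulCols (ι := n) g.transpose).comp volume_preserving_transpose)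
  refine (funext fun A => ?_ : _ = rightMul (g : Matrix n n ℝ)) ▸ h
  ext i j
  simp [rightMul, mulCols, Matrix.mul_apply, mulVec, dotProduct, mul_comm]

theorem det_colMat_mulCols (g : SpecialLinearGroup n ℝ) (A : n → n → ℝ) :
    (colMat (mulCols (g : Matrix n n ℝ) A)).det = (colMat A).det := by
  rw [colMat_mulCols, det_mul, Matrix.SpecialLinearGroup.det_coe, one_mul]

theorem det_colMat_rightMul (g : SpecialLinearGroup n ℝ) (A : n → n → ℝ) :
    (colMat (rightMul (g : Matrix n n ℝ) A)).det = (colMat A).det := by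
  rw [colMat_rightMul, det_mul, Matrix.SpecialLinearGroup.det_coe, mul_one]

/-- The density `(det A)⁻ⁿ` of a Haar measure of `GL_n(ℝ)` with respect to Lebesgue measure, cut off
to determinants in `[1, 2]`. -/
def detDensity (A : n → n → ℝ) : ℝ≥0∞ :=
  if (colMat A).det ∈ Icc (1 : ℝ) 2 then ENNReal.ofReal (((colMat A).det)⁻¹ ^ Fintype.card n) else 0

theorem measurable_detDensity : Measurable (detDensity (n := n)) :=
  Measurable.ite (measurable_det_colMat measurableSet_Icc)
    (measurable_det_colMat.inv.pow_const _).ennreal_ofReal measurable_const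

theorem detDensity_le_one (A : n → n → ℝ) : detDensity A ≤ 1 := by
  unfold detDensity
  split_ifs with h
  · rw [← ENNReal.ofReal_one]
    refine ENNReal.ofReal_le_ofReal (pow_le_one₀ ?_ (inv_le_one_of_one_le₀ h.1))
    exact inv_nonneg.2 (zero_le_one.trans h.1)
  · exact zero_le_one

theorem detDensity_congr {A B : n → n → ℝ} (h : (colMat A).det = (colMat B).det) :
    detDensity A = detDensity B := by
  simp only [detDensity, h]

theorem detDensity_ne_zero_iff {A : n → n → ℝ} :
    detDensity A ≠ 0 ↔ (colMat A).det ∈ Icc (1 : ℝ) 2 := by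
  refine ⟨fun h => not_imp_comm.1 (fun h' => if_neg h') h, fun h => ?_⟩
  have : 0 < (colMat A).det := zero_lt_one.trans_le h.1
  rw [detDensity, if_pos h]
  positivity

theorem det_pos_of_detDensity_ne_zero {A : n → n → ℝ} (h : detDensity A ≠ 0) :
    0 < (colMat A).det :=
  zero_lt_one.trans_le (detDensity_ne_zero_iff.1 h).1

theorem exists_det_mem_Ioo [Nonempty n] : ∃ A : n → n → ℝ, (colMat A).det ∈ Ioo (1 : ℝ) 2 := by
  obtain ⟨j⟩ := ‹Nonempty n›
  refine ⟨(diagonal (Pi.mulSingle j (3 / 2)))ᵀ, ?_⟩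
  rw [show colMat (diagonal (Pi.mulSingle j (3 / 2)))ᵀ = diagonal (Pi.mulSingle j (3 / 2 : ℝ)) from
    rfl, det_diagonal, Finset.prod_pi_mulSingle']
  norm_num

theorem lintegral_detDensity_ne_zero [Nonempty n] :
    ∫⁻ A : n → n → ℝ, detDensity A ≠ 0 := by
  rw [Ne, lintegral_eq_zero_iff measurable_detDensity]
  intro h
  have hopen : IsOpen {A : n → n → ℝ | (colMat A).det ∈ Ioo (1 : ℝ) 2} :=
    isOpen_Ioo.preimage continuous_det_colMat
  exact (hopen.measure_pos volume exists_det_mem_Ioo).ne' <| measure_mono_null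
    (fun A hA => detDensity_ne_zero_iff.2 (Ioo_subset_Icc_self hA)) h

/-- The elements of `SL_n(ℝ)` whose entries are bounded by `R`. -/
def slBox (R : ℝ) : Set (SpecialLinearGroup n ℝ) := {g | ∀ i j, |(g : Matrix n n ℝ) i j| ≤ R}

theorem measurableSet_slBox (R : ℝ) : MeasurableSet (slBox (n := n) R) := by
  simp only [slBox, ofPred_forall]
  exact MeasurableSet.iInter fun i => MeasurableSet.iInter fun j =>
    (measurable_sl_apply i j).abs measurableSet_Iic

theorem iUnion_slBox : ⋃ m : ℕ, slBox (n := n) m = univ := by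
  refine eq_univ_of_forall fun g => mem_iUnion.2 ?_
  obtain ⟨C, hC⟩ := (finite_range fun p : n × n => |(g : Matrix n n ℝ) p.1 p.2|).bddAbove
  obtain ⟨m, hm⟩ := exists_nat_ge C
  exact ⟨m, fun i j => (hC ⟨(i, j), rfl⟩).trans hm⟩

end SpecialLinearGroup

section Haar

/-- A way `A ↦ A · diag(factor (det A))` of rescaling the columns of a matrix `A` of positive
determinant to make its determinant equal to one. The bound from below makes the rescaling of a
matrix with determinant in `[1, 2]` proper. -/
structure ColumnScaling (n : Type*) [Fintype n] where
  factor : ℝ → n → ℝ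
  measurable_factor : Measurable factor
  prod_factor : ∀ t, 0 < t → ∏ i, factor t i = t⁻¹
  half_le_factor : ∀ t ∈ Icc (1 : ℝ) 2, ∀ i, 2⁻¹ ≤ factor t i

namespace ColumnScaling

variable {n : Type*} [Fintype n] [DecidableEq n]

/-- The scaling of the column `j`, which leaves the other columns unchanged. -/
def single (j : n) : ColumnScaling n where
  factor t := Pi.mulSingle j t⁻¹
  measurable_factor := measurable_pi_iff.2 fun i => by
    by_cases h : i = j
    · subst h
      simpa only [Pi.mulSingle_eq_same] using measurable_inv
    · simpa only [Pi.mulSingle_eq_of_ne h] using measurable_const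
  prod_factor t _ := by
    rw [Finset.prod_pi_mulSingle', if_pos (Finset.mem_univ j)]
  half_le_factor t ht i := by
    by_cases h : i = j
    · subst h
      simpa only [Pi.mulSingle_eq_same] using inv_anti₀ (zero_lt_one.trans_le ht.1) ht.2
    · rw [Pi.mulSingle_eq_of_ne h]
      norm_num

theorem single_factor (j : n) (t : ℝ) : (single j).factor t = Pi.mulSingle j t⁻¹ := rfl

/-- The scaling of all columns by the same factor. -/
def uniform (n : Type*) [Fintype n] [Nonempty n] : ColumnScaling n where
  factor t _ := t ^ (-(Fintype.card n : ℝ)⁻¹)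
  measurable_factor := measurable_pi_iff.2 fun _ => measurable_id.pow_const _
  prod_factor t ht := by
    rw [Finset.prod_const, Finset.card_univ, ← Real.rpow_natCast, ← Real.rpow_mul ht.le, neg_mul,
      inv_mul_cancel₀ (by simp), Real.rpow_neg_one]
  half_le_factor t ht _ := by
    have hcard : (Fintype.card n : ℝ)⁻¹ ≤ 1 :=
      inv_le_one_of_one_le₀ (by exact_mod_cast Fintype.card_pos)
    calc (2 : ℝ)⁻¹ ≤ t⁻¹ := inv_anti₀ (zero_lt_one.trans_le ht.1) ht.2
      _ = t ^ (-1 : ℝ) := (Real.rpow_neg_one t).symm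
      _ ≤ t ^ (-(Fintype.card n : ℝ)⁻¹) :=
        Real.rpow_le_rpow_of_exponent_le ht.1 (neg_le_neg hcard)

variable (c : ColumnScaling n)

/-- The rescaled matrix, with the junk value `1` if the determinant is not positive. -/
def normalize (A : n → n → ℝ) : SpecialLinearGroup n ℝ :=
  if h : 0 < (colMat A).det then
    ⟨colMat A * diagonal (c.factor (colMat A).det), by
      rw [det_mul, det_diagonal, c.prod_factor _ h, mul_inv_cancel₀ h.ne']⟩
  else 1

theorem coe_normalize {A : n → n → ℝ} (h : 0 < (colMat A).det) :
    (c.normalize A : Matrix n n ℝ) = colMat A * diagonal (c.factor (colMat A).det) := by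
  exact congrArg Subtype.val (dif_pos h)

theorem measurable_normalize : Measurable c.normalize := by
  refine measurable_sl_iff.2 fun i j => ?_
  have happly : (fun A => (c.normalize A : Matrix n n ℝ) i j) = fun A =>
      if 0 < (colMat A).det then A j i * c.factor (colMat A).det j else (1 : Matrix n n ℝ) i j := by
    funext A
    split_ifs with h
    · rw [c.coe_normalize h, mul_diagonal, colMat_apply]
    · exact congrArg (fun g : SpecialLinearGroup n ℝ => (g : Matrix n n ℝ) i j) (dif_neg h)
  rw [happly]
  exact Measurable.ite (measurable_det_colMat measurableSet_Ioi) (Measurable.mul (by fun_prop)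
    ((measurable_pi_iff.1 c.measurable_factor j).comp measurable_det_colMat)) measurable_const

theorem normalize_mulCols (g : SpecialLinearGroup n ℝ) {A : n → n → ℝ}
    (h : 0 < (colMat A).det) :
    c.normalize (mulCols (g : Matrix n n ℝ) A) = g * c.normalize A := by
  apply Subtype.ext
  rw [c.coe_normalize (by rwa [det_colMat_mulCols]), Matrix.SpecialLinearGroup.coe_mul,
    c.coe_normalize h, det_colMat_mulCols, colMat_mulCols, Matrix.mul_assoc]

theorem normalize_uniform_rightMul [Nonempty n] (g : SpecialLinearGroup n ℝ) {A : n → n → ℝ}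
    (h : 0 < (colMat A).det) :
    (uniform n).normalize (rightMul (g : Matrix n n ℝ) A) = (uniform n).normalize A * g := by
  apply Subtype.ext
  rw [coe_normalize _ (by rwa [det_colMat_rightMul]), Matrix.SpecialLinearGroup.coe_mul,
    coe_normalize _ h, det_colMat_rightMul, colMat_rightMul]
  simp only [uniform, ← smul_one_eq_diagonal, Matrix.mul_smul, Matrix.smul_mul, Matrix.mul_one]

theorem abs_le_two_mul_abs_normalize {A : n → n → ℝ} (h : (colMat A).det ∈ Icc (1 : ℝ) 2)
    (i j : n) : |A j i| ≤ 2 * |(c.normalize A : Matrix n n ℝ) i j| := by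
  have hfactor := (c.half_le_factor _ h j).trans (le_abs_self _)
  rw [c.coe_normalize (zero_lt_one.trans_le h.1), mul_diagonal, colMat_apply, abs_mul]
  nlinarith [abs_nonneg (A j i)]

/-- The Haar measure on `SL_n(ℝ)` obtained by rescaling the columns of matrices with determinant in
`[1, 2]`. Different scalings give proportional measures. -/
def haar : Measure (SpecialLinearGroup n ℝ) :=
  (volume.withDensity detDensity).map c.normalize

theorem lintegral_haar {F : SpecialLinearGroup n ℝ → ℝ≥0∞} (hF : Measurable F) :
    ∫⁻ g, F g ∂c.haar = ∫⁻ A, detDensity A * F (c.normalize A) := by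
  rw [haar, lintegral_map hF c.measurable_normalize]
  exact lintegral_withDensity_eq_lintegral_mul _ measurable_detDensity
    (hF.comp c.measurable_normalize)

theorem map_haar_eq_self {T : (n → n → ℝ) → n → n → ℝ} (hT : MeasurePreserving T volume volume)
    (hdet : ∀ A, (colMat (T A)).det = (colMat A).det)
    {S : SpecialLinearGroup n ℝ → SpecialLinearGroup n ℝ} (hS : Measurable S)
    (hTS : ∀ A, 0 < (colMat A).det → c.normalize (T A) = S (c.normalize A)) :
    c.haar.map S = c.haar := by
  refine Measure.ext_of_lintegral _ fun F hF => ?_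
  rw [lintegral_map hF hS, c.lintegral_haar (F := fun g => F (S g)) (hF.comp hS),
    c.lintegral_haar hF, ← hT.lintegral_comp (f := fun A => detDensity A * F (c.normalize A))
      (measurable_detDensity.mul (hF.comp c.measurable_normalize))]
  refine lintegral_congr fun A => ?_
  rw [detDensity_congr (hdet A)]
  by_cases h : detDensity A = 0
  · simp only [h, zero_mul]
  · rw [hTS A (det_pos_of_detDensity_ne_zero h)]

instance isMulLeftInvariant_haar : c.haar.IsMulLeftInvariant :=
  ⟨fun g => c.map_haar_eq_self (volume_preserving_mulCols g) (det_colMat_mulCols g)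
    (measurable_const_mul g) fun _ => c.normalize_mulCols g⟩

theorem isMulRightInvariant_haar_uniform [Nonempty n] : (uniform n).haar.IsMulRightInvariant :=
  ⟨fun g => (uniform n).map_haar_eq_self (volume_preserving_rightMul g) (det_colMat_rightMul g)
    (measurable_mul_const g) fun _ => normalize_uniform_rightMul g⟩

theorem haar_slBox_lt_top (R : ℝ) : c.haar (slBox R) < ∞ := by
  have hpre := c.measurable_normalize (measurableSet_slBox R)
  have hball : ∀ A ∈ c.normalize ⁻¹' slBox R, detDensity A ≤
      (Metric.closedBall (0 : n → n → ℝ) |2 * R|).indicator 1 A := by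
    intro A hA
    by_cases h : detDensity A = 0
    · simp only [h, zero_le]
    · have hmem : A ∈ Metric.closedBall (0 : n → n → ℝ) |2 * R| := by
        simp only [mem_closedBall_zero_iff, pi_norm_le_iff_of_nonneg (abs_nonneg (2 * R))]
        intro j i
        calc |A j i| ≤ 2 * |(c.normalize A : Matrix n n ℝ) i j| :=
              c.abs_le_two_mul_abs_normalize (detDensity_ne_zero_iff.1 h) i j
          _ ≤ 2 * R := mul_le_mul_of_nonneg_left (hA i j) zero_le_two
          _ ≤ |2 * R| := le_abs_self _
      simpa only [indicator_of_mem hmem, Pi.one_apply] using detDensity_le_one A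
  rw [haar, Measure.map_apply c.measurable_normalize (measurableSet_slBox R),
    withDensity_apply _ hpre]
  calc ∫⁻ A in c.normalize ⁻¹' slBox R, detDensity A
      ≤ ∫⁻ A in c.normalize ⁻¹' slBox R, (Metric.closedBall 0 |2 * R|).indicator 1 A :=
        setLIntegral_mono' hpre hball
    _ ≤ ∫⁻ A : n → n → ℝ, (Metric.closedBall 0 |2 * R|).indicator 1 A :=
        setLIntegral_le_lintegral _ _
    _ = volume (Metric.closedBall (0 : n → n → ℝ) |2 * R|) :=
        lintegral_indicator_one Metric.isClosed_closedBall.measurableSet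
    _ < ∞ := measure_closedBall_lt_top

instance sigmaFinite_haar : SigmaFinite c.haar :=
  ⟨⟨{ set := fun i : ℕ => slBox i
      set_mem := fun _ => trivial
      finite := fun i => c.haar_slBox_lt_top i
      spanning := iUnion_slBox }⟩⟩

theorem haar_ne_zero [Nonempty n] : c.haar ≠ 0 := by
  intro h
  have hmass := c.lintegral_haar (F := fun _ => 1) measurable_const
  simp only [h, lintegral_zero_measure, mul_one] at hmass
  exact lintegral_detDensity_ne_zero hmass.symm

instance isMulRightInvariant_haar [Nonempty n] : c.haar.IsMulRightInvariant := by
  obtain ⟨a, ha⟩ := exists_eq_smul_of_isMulLeftInvariant (m' := c.haar) (uniform n).haar_ne_zero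
  have := isMulRightInvariant_haar_uniform (n := n)
  refine ⟨fun g => ?_⟩
  rw [ha, Measure.map_smul, map_mul_right_eq_self]

end ColumnScaling

end Haar

section LatticeGroup

variable {n : Type*} [Fintype n] [DecidableEq n]

/-- The inclusion of `SL_n(ℤ)` in `SL_n(ℝ)`. -/
def slInt : SpecialLinearGroup n ℤ →* SpecialLinearGroup n ℝ :=
  Matrix.SpecialLinearGroup.map (Int.castRingHom ℝ)

@[simp] theorem slInt_apply (γ : SpecialLinearGroup n ℤ) (i j : n) :
    (slInt γ : Matrix n n ℝ) i j = ((γ : Matrix n n ℤ) i j : ℝ) := rfl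

theorem eventually_slInt_eq_imp_eq_one :
    ∀ᶠ g in nhds (1 : SpecialLinearGroup n ℝ), ∀ γ, slInt γ = g → γ = 1 := by
  have hsmall : ∀ᶠ g : SpecialLinearGroup n ℝ in nhds 1, ∀ i j,
      |(g : Matrix n n ℝ) i j - (1 : Matrix n n ℝ) i j| < 1 := by
    refine Filter.eventually_all.2 fun i => Filter.eventually_all.2 fun j => ?_
    refine ((continuous_sl_apply i j).sub continuous_const).abs.continuousAt.eventually_lt
      continuousAt_const ?_
    simp
  filter_upwards [hsmall] with _ hg γ rfl
  refine Matrix.SpecialLinearGroup.ext _ _ fun i j => sub_eq_zero.1 (Int.abs_lt_one_iff.1 ?_)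
  have hij := hg i j
  rw [slInt_apply, show (1 : Matrix n n ℝ) i j = ((1 : Matrix n n ℤ) i j : ℝ) by
    simp [Matrix.one_apply]] at hij
  exact_mod_cast hij

/-- A weight on `SL_n(ℝ)` for `SL_n(ℤ)`. -/
def slWeight : SpecialLinearGroup n ℝ → ℝ≥0∞ :=
  (exists_isWeight eventually_slInt_eq_imp_eq_one).choose

theorem isWeight_slWeight : IsWeight slInt (slWeight (n := n)) :=
  (exists_isWeight eventually_slInt_eq_imp_eq_one).choose_spec

/-- The Haar measure on `SL_n(ℝ)` obtained by rescaling the column `j`. -/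
def slHaar (j : n) : Measure (SpecialLinearGroup n ℝ) := (ColumnScaling.single j).haar

instance isMulLeftInvariant_slHaar (j : n) : (slHaar j).IsMulLeftInvariant :=
  ColumnScaling.isMulLeftInvariant_haar _

instance isMulRightInvariant_slHaar (j : n) : (slHaar j).IsMulRightInvariant :=
  haveI : Nonempty n := ⟨j⟩
  ColumnScaling.isMulRightInvariant_haar _

instance sigmaFinite_slHaar (j : n) : SigmaFinite (slHaar j) := ColumnScaling.sigmaFinite_haar _

theorem slHaar_ne_zero (j : n) : slHaar j ≠ 0 :=
  haveI : Nonempty n := ⟨j⟩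
  ColumnScaling.haar_ne_zero _

/-- The covolume of `SL_n(ℤ)` in `SL_n(ℝ)` with respect to `slHaar j`. -/
def slCovolume (j : n) : ℝ≥0∞ := ∫⁻ g, slWeight g ∂slHaar j

theorem slCovolume_ne_zero (j : n) : slCovolume j ≠ 0 := by
  rw [slCovolume, Ne, lintegral_eq_zero_iff isWeight_slWeight.measurable]
  intro h
  exact slHaar_ne_zero j <| Measure.measure_univ_eq_zero.1 <|
    measure_mono_null (fun g _ => (isWeight_slWeight.pos g).ne') h

end LatticeGroup

section Completion

theorem ae_det_colMat_ne_zero {n : Type*} [Fintype n] [DecidableEq n] [Nonempty n] :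
    ∀ᵐ A : n → n → ℝ, (colMat A).det ≠ 0 := by
  have hline : ∀ (A : n → n → ℝ) (t : ℝ), (colMat (A + t • fun i => (1 : Matrix n n ℝ) i)).det =
      (-colMat A).charpoly.eval t := by
    intro A t
    rw [eval_charpoly, sub_neg_eq_add, add_comm]
    congr 1
    ext i j
    simp [Matrix.one_apply, diagonal_apply, @eq_comm _ j i]
  refine ae_mem_of_ae_add_linearMap_mem
    (LinearMap.toSpanSingleton ℝ (n → n → ℝ) fun i => (1 : Matrix n n ℝ) i) volume volume
    (measurable_det_colMat (measurableSet_singleton 0).compl) fun A => ?_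
  refine measure_mono_null (fun t ht => ?_)
    (((-colMat A).charpoly.rootSet_finite ℝ).measure_zero volume)
  rw [Polynomial.mem_rootSet_of_ne (charpoly_monic _).ne_zero, Polynomial.coe_aeval_eq_eval,
    ← hline]
  exact not_not.1 ht

variable {ι κ : Type*}

theorem measurable_sumElim :
    Measurable fun p : (ι → ι ⊕ κ → ℝ) × (κ → ι ⊕ κ → ℝ) => (Sum.elim p.1 p.2 : ι ⊕ κ → _) :=
  (MeasurableEquiv.sumPiEquivProdPi fun _ : ι ⊕ κ => ι ⊕ κ → ℝ).symm.measurable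

theorem volume_preserving_sumElim [Fintype ι] [Fintype κ] :
    MeasurePreserving (fun p : (ι → ι ⊕ κ → ℝ) × (κ → ι ⊕ κ → ℝ) =>
      (Sum.elim p.1 p.2 : ι ⊕ κ → ι ⊕ κ → ℝ)) (volume.prod volume) volume :=
  volume_measurePreserving_sumPiEquivProdPi_symm fun _ : ι ⊕ κ => ι ⊕ κ → ℝ

theorem continuous_sumElim_right (v : ι → ι ⊕ κ → ℝ) :
    Continuous fun r : κ → ι ⊕ κ → ℝ => (Sum.elim v r : ι ⊕ κ → ι ⊕ κ → ℝ) := by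
  refine continuous_pi fun x => ?_
  rcases x with x | x <;> simp only [Sum.elim_inl, Sum.elim_inr] <;> fun_prop

/-- The first columns of a matrix. -/
def leftCols {R : Type*} (g : Matrix (ι ⊕ κ) (ι ⊕ κ) R) : ι → ι ⊕ κ → R :=
  fun i l => g l (Sum.inl i)

variable [Fintype ι] [DecidableEq ι] [Fintype κ] [DecidableEq κ]

/-- A tuple of vectors is completable if it is part of a positively oriented basis. -/
def Completable (v : ι → ι ⊕ κ → ℝ) : Prop :=
  ∃ r : κ → ι ⊕ κ → ℝ, 0 < (colMat (Sum.elim v r)).det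

theorem completable_leftCols (g : SpecialLinearGroup (ι ⊕ κ) ℝ) :
    Completable (leftCols (g : Matrix (ι ⊕ κ) (ι ⊕ κ) ℝ)) := by
  refine ⟨fun a l => (g : Matrix (ι ⊕ κ) (ι ⊕ κ) ℝ) l (Sum.inr a), ?_⟩
  have : colMat (Sum.elim (leftCols (g : Matrix (ι ⊕ κ) (ι ⊕ κ) ℝ))
      fun a l => (g : Matrix (ι ⊕ κ) (ι ⊕ κ) ℝ) l (Sum.inr a)) = g := by
    ext i (x | x) <;> rfl
  rw [this, Matrix.SpecialLinearGroup.det_coe]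
  exact zero_lt_one

theorem completable_of_det_ne_zero (j : κ) {v : ι → ι ⊕ κ → ℝ} {r : κ → ι ⊕ κ → ℝ}
    (h : (colMat (Sum.elim v r)).det ≠ 0) : Completable v := by
  have hneg : (colMat (Sum.elim v (Function.update r j (-r j)))).det =
      -(colMat (Sum.elim v r)).det := by
    have hupdate : colMat (Sum.elim v (Function.update r j (-r j))) =
        (colMat (Sum.elim v r)).updateCol (Sum.inr j) ((-1 : ℝ) • r j) := by
      rw [← Sum.update_elim_inr, neg_one_smul]
      ext i x
      simp only [colMat_apply, updateCol_apply, Function.update_apply]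
      split_ifs <;> rfl
    rw [hupdate, det_updateCol_smul, neg_one_mul]
    exact congrArg (fun M => -det M) (updateCol_eq_self (colMat (Sum.elim v r)) (Sum.inr j))
  rcases h.lt_or_gt with h | h
  · exact ⟨_, hneg ▸ neg_pos.2 h⟩
  · exact ⟨r, h⟩

theorem ae_completable (j : κ) : ∀ᵐ v : ι → ι ⊕ κ → ℝ, Completable v := by
  have : Nonempty (ι ⊕ κ) := ⟨Sum.inr j⟩
  have hprod := volume_preserving_sumElim.quasiMeasurePreserving.ae
    (ae_det_colMat_ne_zero (n := ι ⊕ κ))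
  filter_upwards [Measure.ae_ae_of_ae_prod hprod] with v hv
  obtain ⟨r, hr⟩ := hv.exists
  exact completable_of_det_ne_zero j hr

theorem isOpen_setOf_completable : IsOpen {v : ι → ι ⊕ κ → ℝ | Completable v} := by
  simp only [Completable, ofPred_exists]
  refine isOpen_iUnion fun r => isOpen_Ioi.preimage (continuous_det_colMat.comp ?_)
  refine continuous_pi fun x => ?_
  rcases x with x | x <;> simp only [Sum.elim_inl, Sum.elim_inr] <;> fun_prop

/-- A sequence of candidates for the remaining columns of a matrix. -/
def columnSeq (i : ℕ) : κ → ι ⊕ κ → ℝ := TopologicalSpace.denseSeq (κ → ι ⊕ κ → ℝ) i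

theorem exists_columnSeq (v : ι → ι ⊕ κ → ℝ) :
    ∃ i, 0 < (colMat (Sum.elim v (columnSeq i))).det ∨ ¬Completable v := by
  by_cases hv : Completable v
  · obtain ⟨i, hi⟩ := (TopologicalSpace.denseRange_denseSeq (κ → ι ⊕ κ → ℝ)).exists_mem_open
      (isOpen_Ioi.preimage (continuous_det_colMat.comp (continuous_sumElim_right v))) hv
    exact ⟨i, Or.inl hi⟩
  · exact ⟨0, Or.inr hv⟩

open Classical in
/-- A measurable choice of a matrix of determinant one whose first columns are `v`, with a junk
value if `v` is not completable. -/
def completion (j : κ) (v : ι → ι ⊕ κ → ℝ) : SpecialLinearGroup (ι ⊕ κ) ℝ :=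
  (ColumnScaling.single (Sum.inr j)).normalize
    (Sum.elim v (columnSeq (Nat.find (exists_columnSeq v))))

theorem measurable_completion (j : κ) : Measurable (completion (ι := ι) j) := by
  classical
  have helim (i : ℕ) : Measurable fun v : ι → ι ⊕ κ → ℝ =>
      (Sum.elim v (columnSeq i) : ι ⊕ κ → ι ⊕ κ → ℝ) :=
    measurable_sumElim.comp (measurable_id.prodMk measurable_const)
  exact Measurable.find
    (p := fun i v => 0 < (colMat (Sum.elim v (columnSeq i))).det ∨ ¬Completable v)
    (f := fun i v => (ColumnScaling.single (Sum.inr j)).normalize (Sum.elim v (columnSeq i)))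
    (fun i => (ColumnScaling.measurable_normalize _).comp (helim i))
    (fun i => (measurable_det_colMat.comp (helim i) measurableSet_Ioi).union
      isOpen_setOf_completable.measurableSet.compl) exists_columnSeq

theorem leftCols_normalize_single (j : κ) (v : ι → ι ⊕ κ → ℝ) (r : κ → ι ⊕ κ → ℝ)
    (h : 0 < (colMat (Sum.elim v r)).det) :
    leftCols ((ColumnScaling.single (Sum.inr j)).normalize (Sum.elim v r) :
      Matrix (ι ⊕ κ) (ι ⊕ κ) ℝ) = v := by
  funext i l
  rw [leftCols, ColumnScaling.coe_normalize _ h, mul_diagonal, colMat_apply, Sum.elim_inl,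
    ColumnScaling.single_factor, Pi.mulSingle_eq_of_ne Sum.inl_ne_inr, mul_one]

theorem leftCols_completion (j : κ) {v : ι → ι ⊕ κ → ℝ} (hv : Completable v) :
    leftCols (completion j v : Matrix (ι ⊕ κ) (ι ⊕ κ) ℝ) = v := by
  classical
  exact leftCols_normalize_single j v _
    ((Nat.find_spec (exists_columnSeq v)).resolve_right (not_not.2 hv))

end Completion

section BlockWeight

variable {ι κ : Type*}

theorem volume_preserving_sumElim_cols [Fintype ι] [Fintype κ] :
    MeasurePreserving (fun (p : (κ → ι → ℝ) × (κ → κ → ℝ)) (c : κ) =>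
      (Sum.elim (p.1 c) (p.2 c) : ι ⊕ κ → ℝ)) (volume.prod volume) volume :=
  (volume_preserving_pi fun _ : κ =>
    volume_measurePreserving_sumPiEquivProdPi_symm fun _ : ι ⊕ κ => ℝ).comp
      (volume_measurePreserving_arrowProdEquivProdArrow (ι → ℝ) (κ → ℝ) κ).symm

theorem single_factor_pos [Fintype κ] [DecidableEq κ] (j c : κ) {t : ℝ} (ht : 0 < t) :
    0 < (ColumnScaling.single j).factor t c := by
  rw [ColumnScaling.single_factor, Pi.mulSingle_apply]
  split_ifs <;> positivity

/-- The upper right blocks that lie in the unit box after rescaling the column `j` by `t⁻¹`. -/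
def scaledBox (ι : Type*) [Fintype κ] [DecidableEq κ] (j : κ) (t : ℝ) : Set (κ → ι → ℝ) :=
  univ.pi fun c => univ.pi fun _ => Ico 0 ((ColumnScaling.single j).factor t c)⁻¹

theorem volume_scaledBox [Fintype ι] [Fintype κ] [DecidableEq κ] (j : κ) {t : ℝ} (ht : 0 < t) :
    volume (scaledBox ι j t) = ENNReal.ofReal (t ^ Fintype.card ι) := by
  simp only [scaledBox, volume_pi_pi, Real.volume_Ico, sub_zero, Finset.prod_const,
    Finset.card_univ]
  rw [Finset.prod_pow, ← ENNReal.ofReal_prod_of_nonneg fun c _ =>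
      (inv_pos.2 (single_factor_pos j c ht)).le, Finset.prod_inv_distrib,
    ColumnScaling.prod_factor _ t ht, inv_inv, ENNReal.ofReal_pow ht.le]

variable [DecidableEq ι] [DecidableEq κ]

/-- The first standard basis vectors. -/
def stdLeft (ι κ : Type*) [DecidableEq ι] [DecidableEq κ] : ι → ι ⊕ κ → ℝ :=
  leftCols (1 : Matrix (ι ⊕ κ) (ι ⊕ κ) ℝ)

/-- The columns of the block upper triangular matrix with diagonal blocks `1` and `h` and upper
right block `a`, both blocks being given by their columns. -/
def blockCols (a : κ → ι → ℝ) (h : κ → κ → ℝ) : ι ⊕ κ → ι ⊕ κ → ℝ :=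
  Sum.elim (stdLeft ι κ) fun c => Sum.elim (a c) (h c)

theorem colMat_blockCols (a : κ → ι → ℝ) (h : κ → κ → ℝ) :
    colMat (blockCols a h) = fromBlocks 1 (Matrix.of a)ᵀ 0 (colMat h) := by
  ext (x | x) (y | y) <;> simp [blockCols, stdLeft, leftCols, Matrix.one_apply]

variable [Fintype ι] [Fintype κ]

theorem single_factor_inr (j c : κ) (t : ℝ) :
    (ColumnScaling.single (Sum.inr j : ι ⊕ κ)).factor t (Sum.inr c) =
      (ColumnScaling.single j).factor t c := by
  simp only [ColumnScaling.single_factor, Pi.mulSingle_apply, Sum.inr.injEq]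

theorem normalize_single_coe (j : κ) (g : SpecialLinearGroup κ ℝ) :
    (ColumnScaling.single j).normalize (g : Matrix κ κ ℝ)ᵀ = g := by
  have hdet : (colMat (g : Matrix κ κ ℝ)ᵀ).det = 1 := Matrix.SpecialLinearGroup.det_coe g
  refine Subtype.ext ((ColumnScaling.coe_normalize _ (zero_lt_one.trans_eq hdet.symm)).trans ?_)
  rw [hdet, ColumnScaling.single_factor, inv_one, Pi.mulSingle_one,
    show diagonal (1 : κ → ℝ) = 1 from diagonal_one, Matrix.mul_one]
  rfl

open Classical in
/-- The weight of a block upper triangular matrix: its upper right block has to lie in the unit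
box, and its lower right block is weighted by `slWeight`. The normalization only serves to give the
lower right block of an arbitrary matrix determinant one. -/
def blockWeight (j : κ) (g : SpecialLinearGroup (ι ⊕ κ) ℝ) : ℝ≥0∞ :=
  (if ∀ i a, (g : Matrix (ι ⊕ κ) (ι ⊕ κ) ℝ).toBlocks₁₂ i a ∈ Ico (0 : ℝ) 1 then 1 else 0) *
    slWeight ((ColumnScaling.single j).normalize (g : Matrix (ι ⊕ κ) (ι ⊕ κ) ℝ).toBlocks₂₂ᵀ)

theorem measurable_blockWeight (j : κ) : Measurable (blockWeight (ι := ι) j) := by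
  classical
  refine Measurable.mul (Measurable.ite ?_ measurable_const measurable_const) ?_
  · simp only [ofPred_forall]
    exact MeasurableSet.iInter fun i => MeasurableSet.iInter fun a =>
      measurable_sl_apply _ _ measurableSet_Ico
  · exact isWeight_slWeight.measurable.comp ((ColumnScaling.measurable_normalize _).comp
      (measurable_pi_lambda _ fun _ => measurable_pi_lambda _ fun _ => measurable_sl_apply _ _))

theorem det_colMat_blockCols (a : κ → ι → ℝ) (h : κ → κ → ℝ) :
    (colMat (blockCols a h)).det = (colMat h).det := by
  rw [colMat_blockCols, det_fromBlocks_zero₂₁, det_one, one_mul]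

theorem blockWeight_normalize_blockCols (j : κ) (a : κ → ι → ℝ) {h : κ → κ → ℝ}
    (hdet : 0 < (colMat h).det) :
    blockWeight j ((ColumnScaling.single (Sum.inr j)).normalize (blockCols a h)) =
      (scaledBox ι j (colMat h).det).indicator 1 a *
        slWeight ((ColumnScaling.single j).normalize h) := by
  classical
  have hcoe := ColumnScaling.coe_normalize (ColumnScaling.single (Sum.inr j : ι ⊕ κ))
    ((det_colMat_blockCols a h).symm ▸ hdet)
  rw [det_colMat_blockCols] at hcoe
  have h₁₂ (i : ι) (c : κ) : ((ColumnScaling.single (Sum.inr j)).normalize (blockCols a h) :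
      Matrix (ι ⊕ κ) (ι ⊕ κ) ℝ).toBlocks₁₂ i c =
      a c i * (ColumnScaling.single j).factor (colMat h).det c := by
    rw [toBlocks₁₂, of_apply, hcoe, mul_diagonal, single_factor_inr]
    rfl
  have h₂₂ : ((ColumnScaling.single (Sum.inr j)).normalize (blockCols a h) :
      Matrix (ι ⊕ κ) (ι ⊕ κ) ℝ).toBlocks₂₂ =
      ((ColumnScaling.single j).normalize h : Matrix κ κ ℝ) := by
    ext b c
    rw [toBlocks₂₂, of_apply, hcoe, mul_diagonal, single_factor_inr,
      ColumnScaling.coe_normalize _ hdet, mul_diagonal]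
    rfl
  simp only [blockWeight, h₁₂, h₂₂, normalize_single_coe]
  congr 1
  rw [indicator_apply]
  refine if_congr ?_ rfl rfl
  simp only [scaledBox, mem_pi, mem_univ, true_imp_iff]
  rw [forall_comm]
  refine forall_congr' fun c => forall_congr' fun i => ?_
  have hpos := single_factor_pos j c hdet
  rw [mem_Ico, mem_Ico, mul_nonneg_iff_of_pos_right hpos, ← lt_div_iff₀ hpos, one_div]

theorem detDensity_blockCols_mul (a : κ → ι → ℝ) {h : κ → κ → ℝ} (hdens : detDensity h ≠ 0) :
    detDensity (blockCols a h) * ENNReal.ofReal ((colMat h).det ^ Fintype.card ι) =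
      detDensity h := by
  have hpos := det_pos_of_detDensity_ne_zero hdens
  have hmem := detDensity_ne_zero_iff.1 hdens
  rw [detDensity, detDensity, det_colMat_blockCols, if_pos hmem, if_pos hmem,
    ← ENNReal.ofReal_mul (by positivity), Fintype.card_sum, pow_add, mul_right_comm, ← mul_pow,
    inv_mul_cancel₀ hpos.ne', one_pow, one_mul]

theorem lintegral_blockWeight_blockCols (j : κ) (h : κ → κ → ℝ) :
    ∫⁻ a : κ → ι → ℝ, detDensity (blockCols a h) *
        blockWeight j ((ColumnScaling.single (Sum.inr j)).normalize (blockCols a h)) =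
      detDensity h * slWeight ((ColumnScaling.single j).normalize h) := by
  have hconst (a : κ → ι → ℝ) :
      detDensity (blockCols a h) = detDensity (blockCols (0 : κ → ι → ℝ) h) :=
    detDensity_congr (by simp only [det_colMat_blockCols])
  by_cases hdens : detDensity h = 0
  · have hzero (a : κ → ι → ℝ) : detDensity (blockCols a h) = 0 := by
      by_contra ha
      rw [← Ne, detDensity_ne_zero_iff, det_colMat_blockCols, ← detDensity_ne_zero_iff] at ha
      exact ha hdens
    simp only [hzero, hdens, zero_mul, lintegral_zero]
  · have hpos := det_pos_of_detDensity_ne_zero hdens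
    have hbox : MeasurableSet (scaledBox ι j (colMat h).det) :=
      MeasurableSet.univ_pi fun _ => MeasurableSet.univ_pi fun _ => measurableSet_Ico
    simp only [hconst, blockWeight_normalize_blockCols j _ hpos]
    rw [lintegral_const_mul _ (by fun_prop), lintegral_mul_const _ (by fun_prop),
      lintegral_indicator_one hbox, volume_scaledBox j hpos, ← mul_assoc,
      detDensity_blockCols_mul _ hdens]

theorem measurable_blockWeight_normalize (j : κ) :
    Measurable fun r : κ → ι ⊕ κ → ℝ => detDensity (Sum.elim (stdLeft ι κ) r) *
      blockWeight j ((ColumnScaling.single (Sum.inr j)).normalize (Sum.elim (stdLeft ι κ) r)) := by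
  have helim := (continuous_sumElim_right (κ := κ) (stdLeft ι κ)).measurable
  exact (measurable_detDensity.comp helim).mul
    ((measurable_blockWeight j).comp ((ColumnScaling.measurable_normalize _).comp helim))

theorem lintegral_blockWeight (j : κ) :
    ∫⁻ r : κ → ι ⊕ κ → ℝ, detDensity (Sum.elim (stdLeft ι κ) r) *
        blockWeight j ((ColumnScaling.single (Sum.inr j)).normalize (Sum.elim (stdLeft ι κ) r)) =
      slCovolume j := by
  have hmeas := measurable_blockWeight_normalize (ι := ι) j
  rw [slCovolume, slHaar, ColumnScaling.lintegral_haar _ isWeight_slWeight.measurable,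
    ← volume_preserving_sumElim_cols.lintegral_comp hmeas]
  refine (lintegral_prod_symm _
    (hmeas.comp volume_preserving_sumElim_cols.measurable).aemeasurable).trans ?_
  exact lintegral_congr fun h => lintegral_blockWeight_blockCols j h

end BlockWeight

section Unfolding

variable {ι κ : Type*} [Fintype ι] [DecidableEq ι] [Fintype κ] [DecidableEq κ]

/-- The weight with which the sum over the elements of `SL_n(ℤ)` with given first columns is one:
the analogue of `slWeight` for the stabilizer of the first standard basis vectors. -/
def unfoldWeight (j : κ) (g : SpecialLinearGroup (ι ⊕ κ) ℝ) : ℝ≥0∞ :=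
  blockWeight j ((completion j (leftCols (g : Matrix (ι ⊕ κ) (ι ⊕ κ) ℝ)))⁻¹ * g)

theorem measurable_leftCols : Measurable fun g : SpecialLinearGroup (ι ⊕ κ) ℝ =>
    leftCols (g : Matrix (ι ⊕ κ) (ι ⊕ κ) ℝ) :=
  measurable_pi_lambda _ fun i => measurable_pi_lambda _ fun l => measurable_sl_apply l (Sum.inl i)

theorem measurable_unfoldWeight (j : κ) : Measurable (unfoldWeight (ι := ι) j) :=
  (measurable_blockWeight j).comp
    (((measurable_completion j).comp measurable_leftCols).inv.mul measurable_id)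

theorem leftCols_mul (g h : SpecialLinearGroup (ι ⊕ κ) ℝ) :
    leftCols (g * h : SpecialLinearGroup (ι ⊕ κ) ℝ).1 = mulCols g.1 (leftCols h.1) := rfl

theorem mulCols_completion_sumElim (j : κ) {v : ι → ι ⊕ κ → ℝ} (hv : Completable v)
    (r : κ → ι ⊕ κ → ℝ) :
    mulCols (completion j v : Matrix (ι ⊕ κ) (ι ⊕ κ) ℝ) (Sum.elim (stdLeft ι κ) r) =
      Sum.elim v (mulCols (completion j v : Matrix (ι ⊕ κ) (ι ⊕ κ) ℝ) r) := by
  funext x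
  rcases x with i | c
  · have hcol := congrFun (leftCols_mul (completion j v) 1) i
    rw [mul_one, leftCols_completion j hv] at hcol
    exact hcol.symm
  · rfl

/-- The substitution `r ↦ σ r`, where `σ` completes `v`, turns `v` into the standard basis
vectors. -/
theorem unfoldWeight_normalize_completion (j : κ) {v : ι → ι ⊕ κ → ℝ} (hv : Completable v)
    (r : κ → ι ⊕ κ → ℝ)
    (hdens : detDensity (Sum.elim (stdLeft ι κ) r) ≠ 0) :
    unfoldWeight j ((ColumnScaling.single (Sum.inr j)).normalize
        (Sum.elim v (mulCols (completion j v : Matrix (ι ⊕ κ) (ι ⊕ κ) ℝ) r))) =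
      blockWeight j ((ColumnScaling.single (Sum.inr j)).normalize (Sum.elim (stdLeft ι κ) r)) := by
  have hpos := det_pos_of_detDensity_ne_zero hdens
  have hleft := leftCols_normalize_single j v
    (mulCols (completion j v : Matrix (ι ⊕ κ) (ι ⊕ κ) ℝ) r)
    (by rwa [← mulCols_completion_sumElim j hv, det_colMat_mulCols])
  rw [unfoldWeight, hleft, ← mulCols_completion_sumElim j hv,
    ColumnScaling.normalize_mulCols _ _ hpos, inv_mul_cancel_left]

/-- The integrand of `lintegral_unfoldWeight` in the coordinates defining `slHaar`. -/
def unfoldIntegrand (j : κ) (f : (ι → ι ⊕ κ → ℝ) → ℝ≥0∞) (A : ι ⊕ κ → ι ⊕ κ → ℝ) : ℝ≥0∞ :=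
  let g := (ColumnScaling.single (Sum.inr j)).normalize A
  detDensity A * (f (leftCols (g : Matrix (ι ⊕ κ) (ι ⊕ κ) ℝ)) * unfoldWeight j g)

theorem measurable_unfoldIntegrand (j : κ) {f : (ι → ι ⊕ κ → ℝ) → ℝ≥0∞} (hf : Measurable f) :
    Measurable (unfoldIntegrand j f) :=
  measurable_detDensity.mul (((hf.comp measurable_leftCols).mul (measurable_unfoldWeight j)).comp
    (ColumnScaling.measurable_normalize _))

theorem unfoldIntegrand_completion (j : κ) (f : (ι → ι ⊕ κ → ℝ) → ℝ≥0∞) {v : ι → ι ⊕ κ → ℝ}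
    (hv : Completable v) (r : κ → ι ⊕ κ → ℝ) :
    unfoldIntegrand j f (Sum.elim v (mulCols (completion j v : Matrix (ι ⊕ κ) (ι ⊕ κ) ℝ) r)) =
      f v * (detDensity (Sum.elim (stdLeft ι κ) r) *
        blockWeight j ((ColumnScaling.single (Sum.inr j)).normalize
          (Sum.elim (stdLeft ι κ) r))) := by
  have hdet : (colMat (Sum.elim v (mulCols (completion j v : Matrix (ι ⊕ κ) (ι ⊕ κ) ℝ) r))).det =
      (colMat (Sum.elim (stdLeft ι κ) r)).det := by
    rw [← mulCols_completion_sumElim j hv, det_colMat_mulCols]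
  rw [unfoldIntegrand, detDensity_congr hdet]
  by_cases hdens : detDensity (Sum.elim (stdLeft ι κ) r) = 0
  · simp only [hdens, zero_mul, mul_zero]
  · have hpos := hdet ▸ det_pos_of_detDensity_ne_zero hdens
    rw [leftCols_normalize_single j v _ hpos, unfoldWeight_normalize_completion j hv r hdens,
      mul_left_comm]

theorem lintegral_unfoldIntegrand (j : κ) {f : (ι → ι ⊕ κ → ℝ) → ℝ≥0∞} (hf : Measurable f)
    {v : ι → ι ⊕ κ → ℝ} (hv : Completable v) :
    ∫⁻ r : κ → ι ⊕ κ → ℝ, unfoldIntegrand j f (Sum.elim v r) = f v * slCovolume j := by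
  refine ((volume_preserving_mulCols (completion j v)).lintegral_comp
    ((measurable_unfoldIntegrand j hf).comp (continuous_sumElim_right v).measurable)).symm.trans ?_
  simp only [Function.comp_apply, unfoldIntegrand_completion j f hv]
  rw [lintegral_const_mul _ (measurable_blockWeight_normalize j), lintegral_blockWeight]

theorem lintegral_unfoldWeight (j : κ) {f : (ι → ι ⊕ κ → ℝ) → ℝ≥0∞} (hf : Measurable f) :
    ∫⁻ g : SpecialLinearGroup (ι ⊕ κ) ℝ,
        f (leftCols (g : Matrix (ι ⊕ κ) (ι ⊕ κ) ℝ)) * unfoldWeight j g ∂slHaar (Sum.inr j) =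
      (∫⁻ v, f v) * slCovolume j := by
  have hmeas := measurable_unfoldIntegrand j hf
  calc ∫⁻ g : SpecialLinearGroup (ι ⊕ κ) ℝ,
        f (leftCols (g : Matrix (ι ⊕ κ) (ι ⊕ κ) ℝ)) * unfoldWeight j g ∂slHaar (Sum.inr j)
      = ∫⁻ A, unfoldIntegrand j f A := ColumnScaling.lintegral_haar _
        ((hf.comp measurable_leftCols).mul (measurable_unfoldWeight j))
    _ = ∫⁻ v, ∫⁻ r : κ → ι ⊕ κ → ℝ, unfoldIntegrand j f (Sum.elim v r) := by
        rw [← volume_preserving_sumElim.lintegral_comp hmeas]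
        exact lintegral_prod _ (hmeas.comp volume_preserving_sumElim.measurable).aemeasurable
    _ = ∫⁻ v, f v * slCovolume j := lintegral_congr_ae <| (ae_completable j).mono fun _ hv =>
        lintegral_unfoldIntegrand j hf hv
    _ = (∫⁻ v, f v) * slCovolume j := lintegral_mul_const _ hf

end Unfolding

section UnfoldingSum

variable {ι κ : Type*} [DecidableEq ι] [DecidableEq κ]

theorem leftCols_fromBlocks {R : Type*} [Ring R] (b : Matrix ι κ R) (c : Matrix κ κ R) :
    leftCols (fromBlocks 1 b 0 c) = leftCols 1 := by
  rw [← fromBlocks_one]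
  funext i x
  rcases x with x | x <;> rfl

theorem eq_fromBlocks_of_leftCols_eq {R : Type*} [Ring R] {M : Matrix (ι ⊕ κ) (ι ⊕ κ) R}
    (hM : leftCols M = leftCols 1) : M = fromBlocks 1 M.toBlocks₁₂ 0 M.toBlocks₂₂ := by
  have hcol (x : ι ⊕ κ) (i : ι) : M x (Sum.inl i) = (1 : Matrix (ι ⊕ κ) (ι ⊕ κ) R) x (Sum.inl i) :=
    congrFun (congrFun hM i) x
  rw [← fromBlocks_one] at hcol
  ext x (i | c)
  · rcases x with x | x <;> exact hcol _ i
  · rcases x with x | x <;> rfl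

variable [Fintype ι] [Fintype κ]

theorem det_toBlocks₂₂_of_leftCols_eq {R : Type*} [CommRing R]
    {M : SpecialLinearGroup (ι ⊕ κ) R} (hM : leftCols M.1 = leftCols 1) :
    M.1.toBlocks₂₂.det = 1 :=
  calc M.1.toBlocks₂₂.det = (fromBlocks 1 M.1.toBlocks₁₂ 0 M.1.toBlocks₂₂).det := by
        rw [det_fromBlocks_zero₂₁, det_one, one_mul]
    _ = M.1.det := congrArg det (eq_fromBlocks_of_leftCols_eq hM).symm
    _ = 1 := M.2

/-- The lower right block of a matrix whose first columns are the standard basis vectors. -/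
def lowerBlock {R : Type*} [CommRing R] {M : SpecialLinearGroup (ι ⊕ κ) R}
    (hM : leftCols M.1 = leftCols 1) : SpecialLinearGroup κ R :=
  ⟨M.1.toBlocks₂₂, det_toBlocks₂₂_of_leftCols_eq hM⟩

theorem leftCols_mul_congr {R : Type*} [CommRing R] (L : SpecialLinearGroup (ι ⊕ κ) R)
    {M N : SpecialLinearGroup (ι ⊕ κ) R} (h : leftCols M.1 = leftCols N.1) :
    leftCols (L * M).1 = leftCols (L * N).1 := by
  funext i
  exact congrArg (L.1 *ᵥ ·) (congrFun h i)

/-- The integral block upper triangular matrix with diagonal blocks `1` and `γ` and upper right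
block `b`. -/
def blockInt (b : Matrix ι κ ℤ) (γ : SpecialLinearGroup κ ℤ) : SpecialLinearGroup (ι ⊕ κ) ℤ :=
  ⟨fromBlocks 1 b 0 (γ : Matrix κ κ ℤ), by
    rw [det_fromBlocks_zero₂₁, det_one, one_mul, Matrix.SpecialLinearGroup.det_coe]⟩

theorem coe_slInt_blockInt (b : Matrix ι κ ℤ) (γ : SpecialLinearGroup κ ℤ) :
    (slInt (blockInt b γ) : Matrix (ι ⊕ κ) (ι ⊕ κ) ℝ) =
      fromBlocks 1 (b.map (↑)) 0 (slInt γ : Matrix κ κ ℝ) := by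
  refine (fromBlocks_map 1 b 0 (γ : Matrix κ κ ℤ) (fun x : ℤ => (x : ℝ))).trans ?_
  rw [Matrix.map_one _ Int.cast_zero Int.cast_one, Matrix.map_zero _ Int.cast_zero]
  rfl

theorem exists_blockInt_eq {q : SpecialLinearGroup (ι ⊕ κ) ℤ} (hq : leftCols q.1 = leftCols 1) :
    ∃ p : Matrix ι κ ℤ × SpecialLinearGroup κ ℤ, blockInt p.1 p.2 = q :=
  ⟨⟨q.1.toBlocks₁₂, lowerBlock hq⟩, Subtype.ext (eq_fromBlocks_of_leftCols_eq hq).symm⟩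

theorem blockInt_injective :
    Function.Injective fun p : Matrix ι κ ℤ × SpecialLinearGroup κ ℤ => blockInt p.1 p.2 := by
  intro p p' h
  obtain ⟨-, hb, -, hγ⟩ := fromBlocks_inj.1 (congrArg Subtype.val h)
  exact Prod.ext hb (Subtype.ext hγ)

/-- The elements of `SL_n(ℤ)` with the same first columns as `γ₀` are the products of `γ₀` with a
block upper triangular matrix. -/
def fiberEquiv (γ₀ : SpecialLinearGroup (ι ⊕ κ) ℤ) :
    Matrix ι κ ℤ × SpecialLinearGroup κ ℤ ≃
      {γ : SpecialLinearGroup (ι ⊕ κ) ℤ // leftCols γ.1 = leftCols γ₀.1} :=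
  Equiv.ofBijective
    (fun p => ⟨γ₀ * blockInt p.1 p.2, by
      rw [leftCols_mul_congr γ₀ (N := 1) (leftCols_fromBlocks _ _), mul_one]⟩) <| by
    refine ⟨fun p p' h => ?_, fun ⟨γ, hγ⟩ => ?_⟩
    · exact blockInt_injective (mul_left_cancel (congrArg Subtype.val h))
    · have hq := leftCols_mul_congr γ₀⁻¹ hγ
      rw [inv_mul_cancel] at hq
      obtain ⟨p, hp⟩ := exists_blockInt_eq hq
      exact ⟨p, Subtype.ext ((congrArg (γ₀ * ·) hp).trans (mul_inv_cancel_left γ₀ γ))⟩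

theorem forall_add_mem_Ico_iff {ι κ : Type*} (a : Matrix ι κ ℝ) (b : Matrix ι κ ℤ) :
    (∀ i c, (b i c : ℝ) + a i c ∈ Ico (0 : ℝ) 1) ↔ b = Matrix.of fun i c => -⌊a i c⌋ := by
  have hentry (i : ι) (c : κ) : (b i c : ℝ) + a i c ∈ Ico (0 : ℝ) 1 ↔ b i c = -⌊a i c⌋ := by
    rw [eq_comm, neg_eq_iff_eq_neg, Int.floor_eq_iff, mem_Ico, Int.cast_neg]
    constructor <;> rintro ⟨h₀, h₁⟩ <;> constructor <;> linarith
  simp only [hentry, ← Matrix.ext_iff, of_apply]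

open Classical in
theorem blockWeight_mul_blockInt (j : κ) {B : SpecialLinearGroup (ι ⊕ κ) ℝ}
    (hB : leftCols B.1 = stdLeft ι κ) (b : Matrix ι κ ℤ) (γ : SpecialLinearGroup κ ℤ) :
    blockWeight j (B * slInt (blockInt b γ)) =
      (if b = Matrix.of fun i c => -⌊(B.1.toBlocks₁₂ * (slInt γ).1) i c⌋ then 1 else 0) *
        slWeight (lowerBlock hB * slInt γ) := by
  have hmul : (B * slInt (blockInt b γ)).1 = fromBlocks 1
      (b.map (↑) + B.1.toBlocks₁₂ * (slInt γ).1) 0 (B.1.toBlocks₂₂ * (slInt γ).1) :=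
    calc (B * slInt (blockInt b γ)).1
        = fromBlocks 1 B.1.toBlocks₁₂ 0 B.1.toBlocks₂₂ *
            fromBlocks 1 (b.map (↑)) 0 (slInt γ).1 :=
          congrArg₂ (· * ·) (eq_fromBlocks_of_leftCols_eq hB) (coe_slInt_blockInt b γ)
      _ = _ := by
          rw [fromBlocks_multiply]
          simp only [Matrix.one_mul, Matrix.zero_mul, Matrix.mul_zero, add_zero, zero_add]
  rw [blockWeight, hmul, toBlocks_fromBlocks₁₂, toBlocks_fromBlocks₂₂]
  congr 1
  · exact if_congr (forall_add_mem_Ico_iff _ b) rfl rfl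
  · exact congrArg slWeight (normalize_single_coe j (lowerBlock hB * slInt γ))

theorem tsum_blockWeight (j : κ) {B : SpecialLinearGroup (ι ⊕ κ) ℝ}
    (hB : leftCols B.1 = stdLeft ι κ) :
    ∑' p : Matrix ι κ ℤ × SpecialLinearGroup κ ℤ, blockWeight j (B * slInt (blockInt p.1 p.2)) =
      1 := by
  classical
  rw [ENNReal.tsum_prod (f := fun b γ => blockWeight j (B * slInt (blockInt b γ))),
    ENNReal.tsum_comm]
  simp only [blockWeight_mul_blockInt j hB, ENNReal.tsum_mul_right, tsum_ite_eq, one_mul]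
  exact isWeight_slWeight.tsum_eq_one _

theorem leftCols_slInt_congr {γ γ' : SpecialLinearGroup (ι ⊕ κ) ℤ}
    (h : leftCols γ.1 = leftCols γ'.1) : leftCols (slInt γ).1 = leftCols (slInt γ').1 := by
  funext i l
  exact congrArg ((↑) : ℤ → ℝ) (congrFun (congrFun h i) l)

theorem tsum_unfoldWeight (j : κ) (g : SpecialLinearGroup (ι ⊕ κ) ℝ)
    (γ₀ : SpecialLinearGroup (ι ⊕ κ) ℤ) :
    ∑' γ : {γ : SpecialLinearGroup (ι ⊕ κ) ℤ // leftCols γ.1 = leftCols γ₀.1},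
      unfoldWeight j (g * slInt γ.1) = 1 := by
  set σ := completion j (leftCols (g * slInt γ₀).1) with hσ
  have hB : leftCols (σ⁻¹ * (g * slInt γ₀)).1 = stdLeft ι κ := by
    have hcompl := leftCols_completion j (completable_leftCols (g * slInt γ₀))
    rw [leftCols_mul_congr σ⁻¹ hcompl.symm, inv_mul_cancel]
    rfl
  rw [← (fiberEquiv γ₀).tsum_eq, ← tsum_blockWeight j hB]
  refine tsum_congr fun p => ?_
  rw [unfoldWeight, leftCols_mul_congr g (leftCols_slInt_congr (fiberEquiv γ₀ p).2), ← hσ,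
    show (fiberEquiv γ₀ p).1 = γ₀ * blockInt p.1 p.2 from rfl, map_mul, mul_assoc, mul_assoc]

/-- The image of a tuple of integral vectors under a real matrix. -/
def applyInt {ι n : Type*} [Fintype n] (g : Matrix n n ℝ) (u : ι → n → ℤ) : ι → n → ℝ :=
  mulCols g fun i l => (u i l : ℝ)

/-- The integral tuples that are the first columns of an element of `SL_n(ℤ)`. -/
def intPrimitive (ι κ : Type*) [Fintype ι] [DecidableEq ι] [Fintype κ] [DecidableEq κ] :
    Set (ι → ι ⊕ κ → ℤ) :=
  range fun γ : SpecialLinearGroup (ι ⊕ κ) ℤ => leftCols γ.1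

theorem tsum_intPrimitive (j : κ) (f : (ι → ι ⊕ κ → ℝ) → ℝ≥0∞)
    (g : SpecialLinearGroup (ι ⊕ κ) ℝ) :
    ∑' γ, f (leftCols (g * slInt γ).1) * unfoldWeight j (g * slInt γ) =
      ∑' u : intPrimitive ι κ, f (applyInt g.1 u.1) := by
  rw [← (Equiv.sigmaFiberEquiv (rangeFactorization fun γ : SpecialLinearGroup (ι ⊕ κ) ℤ =>
    leftCols γ.1)).tsum_eq, ENNReal.tsum_sigma']
  refine tsum_congr fun ⟨_, γ₀, rfl⟩ => ?_
  let e : {γ // rangeFactorization (fun γ : SpecialLinearGroup (ι ⊕ κ) ℤ => leftCols γ.1) γ =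
        ⟨_, γ₀, rfl⟩} ≃
      {γ : SpecialLinearGroup (ι ⊕ κ) ℤ // leftCols γ.1 = leftCols γ₀.1} :=
    Equiv.subtypeEquivRight fun γ => Subtype.ext_iff
  rw [← mul_one (f _), ← tsum_unfoldWeight j g γ₀, ← ENNReal.tsum_mul_left, ← e.tsum_eq]
  refine tsum_congr fun γ => congrArg₂ (· * ·) (congrArg f ?_) rfl
  exact leftCols_mul_congr g (leftCols_slInt_congr (e γ).2)

theorem lintegral_tsum_intPrimitive (j : κ) {f : (ι → ι ⊕ κ → ℝ) → ℝ≥0∞} (hf : Measurable f) :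
    ∫⁻ g : SpecialLinearGroup (ι ⊕ κ) ℝ,
        slWeight g * ∑' u : intPrimitive ι κ, f (applyInt g.1 u.1) ∂slHaar (Sum.inr j) =
      (∫⁻ v, f v) * slCovolume j := by
  simp only [← tsum_intPrimitive j f]
  rw [← lintegral_unfoldWeight j hf]
  exact isWeight_slWeight.lintegral_mul_tsum
    ((hf.comp measurable_leftCols).mul (measurable_unfoldWeight j))

end UnfoldingSum

section Reindex

variable {m n : Type*} [Fintype m] [Fintype n]

theorem volume_preserving_comp_symm {ι : Type*} [Fintype ι] (E : m ≃ n) :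
    MeasurePreserving fun (A : ι → m → ℝ) i y => A i (E.symm y) :=
  volume_preserving_pi fun _ : ι =>
    volume_preserving_arrowCongr' E (MeasurableEquiv.refl ℝ) (.id volume)

theorem volume_preserving_reindex (E : m ≃ n) :
    MeasurePreserving fun (A : m → m → ℝ) x y => A (E.symm x) (E.symm y) :=
  (volume_preserving_comp_symm E).comp
    (volume_preserving_arrowCongr' E (MeasurableEquiv.refl (m → ℝ)) (.id volume))

variable [DecidableEq m] [DecidableEq n]

/-- The isomorphism of special linear groups given by a bijection between the index types. -/
def slReindex (R : Type*) [CommRing R] (E : m ≃ n) :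
    SpecialLinearGroup m R ≃* SpecialLinearGroup n R where
  toFun g := ⟨g.1.submatrix E.symm E.symm, (det_submatrix_equiv_self _ _).trans g.2⟩
  invFun g := ⟨g.1.submatrix E E, (det_submatrix_equiv_self _ _).trans g.2⟩
  left_inv g := by ext; simp
  right_inv g := by ext; simp
  map_mul' g h := Subtype.ext (submatrix_mul_equiv g.1 h.1 E.symm E.symm E.symm).symm

theorem measurable_slReindex (E : m ≃ n) : Measurable (slReindex ℝ E) :=
  measurable_sl_iff.2 fun i j => measurable_sl_apply (E.symm i) (E.symm j)

theorem det_colMat_reindex (E : m ≃ n) (A : m → m → ℝ) :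
    (colMat fun x y => A (E.symm x) (E.symm y)).det = (colMat A).det :=
  det_submatrix_equiv_self E.symm (colMat A)

theorem detDensity_reindex (E : m ≃ n) (A : m → m → ℝ) :
    detDensity (fun x y => A (E.symm x) (E.symm y)) = detDensity A := by
  simp only [detDensity, det_colMat_reindex, Fintype.card_congr E]

theorem normalize_single_reindex (E : m ≃ n) (j : m) {A : m → m → ℝ} (hA : 0 < (colMat A).det) :
    (ColumnScaling.single (E j)).normalize (fun x y => A (E.symm x) (E.symm y)) =
      slReindex ℝ E ((ColumnScaling.single j).normalize A) := by
  refine Subtype.ext ((ColumnScaling.coe_normalize _ (by rwa [det_colMat_reindex])).trans ?_)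
  change _ = ((ColumnScaling.single j).normalize A).1.submatrix E.symm E.symm
  rw [ColumnScaling.coe_normalize _ hA, det_colMat_reindex]
  ext x y
  simp only [submatrix_apply, mul_diagonal, ColumnScaling.single_factor, Pi.mulSingle_apply,
    colMat_apply, E.symm_apply_eq]

theorem map_slReindex_slHaar (E : m ≃ n) (j : m) :
    Measure.map (slReindex ℝ E) (slHaar j) = slHaar (E j) := by
  refine Measure.ext_of_lintegral _ fun F hF => ?_
  have hcomp := hF.comp (measurable_slReindex E)
  rw [lintegral_map hF (measurable_slReindex E)]
  refine (ColumnScaling.lintegral_haar _ hcomp).trans (.trans ?_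
    (((volume_preserving_reindex E).lintegral_comp (measurable_detDensity.mul
      (hF.comp (ColumnScaling.measurable_normalize _)))).trans
        (ColumnScaling.lintegral_haar _ hF).symm))
  refine lintegral_congr fun A => ?_
  simp only [Pi.mul_apply, Function.comp_apply, detDensity_reindex]
  by_cases hdens : detDensity A = 0
  · rw [hdens, zero_mul, zero_mul]
  · rw [normalize_single_reindex E j (det_pos_of_detDensity_ne_zero hdens)]

theorem lintegral_slWeight_mul_slReindex (E : m ≃ n) (j : m) {H : SpecialLinearGroup n ℝ → ℝ≥0∞}
    (hH : Measurable H) (hinv : ∀ g γ, H (g * slInt γ) = H g) :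
    ∫⁻ g, slWeight g * H g ∂slHaar (E j) = ∫⁻ g, slWeight g * H (slReindex ℝ E g) ∂slHaar j := by
  have hcomm (γ : SpecialLinearGroup m ℤ) : slReindex ℝ E (slInt γ) = slInt (slReindex ℤ E γ) := rfl
  rw [← map_slReindex_slHaar]
  refine (lintegral_map (isWeight_slWeight.measurable.mul hH) (measurable_slReindex E)).trans ?_
  refine (isWeight_slWeight.comp_mulEquiv (measurable_slReindex E) (slReindex ℤ E)
    hcomm).lintegral_mul_eq_lintegral_mul isWeight_slWeight (hH.comp (measurable_slReindex E)) ?_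
  intro g γ
  rw [map_mul, hcomm, hinv]

end Reindex

section PrimitiveTuples

theorem measurable_applyInt {ι n : Type*} [Fintype n] [DecidableEq n] (u : ι → n → ℤ) :
    Measurable fun g : SpecialLinearGroup n ℝ => applyInt g.1 u :=
  measurable_pi_lambda _ fun _ => measurable_pi_lambda _ fun l =>
    Finset.measurable_sum _ fun x _ => (measurable_sl_apply l x).mul_const _

theorem applyInt_mul_slInt {ι n : Type*} [Fintype n] [DecidableEq n]
    (g : SpecialLinearGroup n ℝ) (γ : SpecialLinearGroup n ℤ) (u : ι → n → ℤ) :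
    applyInt (g * slInt γ).1 u = applyInt g.1 fun i => γ.1 *ᵥ u i := by
  funext i
  refine (Matrix.mulVec_mulVec _ g.1 (slInt γ).1).symm.trans (congrArg (g.1 *ᵥ ·) ?_)
  exact funext fun l => ((Int.castRingHom ℝ).map_mulVec γ.1 (u i) l).symm

theorem applyInt_slReindex {ι m n : Type*} [Fintype m] [DecidableEq m] [Fintype n] [DecidableEq n]
    (E : m ≃ n) (g : SpecialLinearGroup m ℝ) (u : ι → n → ℤ) :
    applyInt (slReindex ℝ E g).1 u = fun i y => applyInt g.1 (fun i x => u i (E x)) i (E.symm y) :=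
  funext fun _ => submatrix_mulVec_equiv g.1 _ E.symm E.symm

variable {d e : ℕ}

/-- The tuples of integral vectors formed by the first `d` columns of an element of
`SL_{d+e+1}(ℤ)`. -/
def primInt (d e : ℕ) : Set (Fin d → Fin (d + e + 1) → ℤ) :=
  range fun (γ : SL(d + e + 1, ℤ)) i l => γ.1 l (Fin.castAdd (e + 1) i)

theorem mem_primInt_iff {u : Fin d → Fin (d + e + 1) → ℤ} :
    u ∈ primInt d e ↔
      (fun i x => u i (finSumFinEquiv (n := e + 1) x)) ∈ intPrimitive (Fin d) (Fin (e + 1)) := by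
  constructor
  · rintro ⟨γ, rfl⟩
    exact ⟨slReindex ℤ finSumFinEquiv.symm γ, rfl⟩
  · rintro ⟨γ, hγ⟩
    refine ⟨slReindex ℤ (finSumFinEquiv (n := e + 1)) γ, ?_⟩
    funext i l
    obtain ⟨x, rfl⟩ := (finSumFinEquiv (n := e + 1)).surjective l
    refine .trans ?_ (congrFun (congrFun hγ i) x)
    exact congrArg₂ γ.1 (Equiv.symm_apply_apply _ x) (finSumFinEquiv_symm_apply_castAdd i)

/-- Reindexing identifies the two descriptions of integral primitive tuples. -/
def primIntEquivIntPrimitive (d e : ℕ) : primInt d e ≃ intPrimitive (Fin d) (Fin (e + 1)) :=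
  (Equiv.piCongrRight fun _ => (finSumFinEquiv (n := e + 1)).symm.arrowCongr (.refl ℤ)).subtypeEquiv
    fun _ => mem_primInt_iff

theorem mulVec_mem_primInt (γ : SL(d + e + 1, ℤ)) {u : Fin d → Fin (d + e + 1) → ℤ}
    (hu : u ∈ primInt d e) : (fun i => γ.1 *ᵥ u i) ∈ primInt d e := by
  obtain ⟨γ', rfl⟩ := hu
  exact ⟨γ * γ', rfl⟩

/-- The action of `SL_k(ℤ)` on integral primitive tuples. -/
def primIntPerm (γ : SL(d + e + 1, ℤ)) : Equiv.Perm (primInt d e) where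
  toFun u := ⟨_, mulVec_mem_primInt γ u.2⟩
  invFun u := ⟨_, mulVec_mem_primInt γ⁻¹ u.2⟩
  left_inv u := Subtype.ext <| funext fun i => by
    simp only [Matrix.mulVec_mulVec, ← Matrix.SpecialLinearGroup.coe_mul, inv_mul_cancel,
      Matrix.SpecialLinearGroup.coe_one, Matrix.one_mulVec]
  right_inv u := Subtype.ext <| funext fun i => by
    simp only [Matrix.mulVec_mulVec, ← Matrix.SpecialLinearGroup.coe_mul, mul_inv_cancel,
      Matrix.SpecialLinearGroup.coe_one, Matrix.one_mulVec]

/-- The sum of `f` over the primitive tuples of the lattice `g ℤ^k`, as a function of `g`. -/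
def primTsum (f : (Fin d → Fin (d + e + 1) → ℝ) → ℝ≥0∞) (g : SL(d + e + 1, ℝ)) : ℝ≥0∞ :=
  ∑' u : primInt d e, f (applyInt g.1 u.1)

theorem measurable_primTsum {f : (Fin d → Fin (d + e + 1) → ℝ) → ℝ≥0∞} (hf : Measurable f) :
    Measurable (primTsum f) :=
  Measurable.tsum fun _ => hf.comp (measurable_applyInt _)

theorem primTsum_mul_slInt (f : (Fin d → Fin (d + e + 1) → ℝ) → ℝ≥0∞)
    (g : SL(d + e + 1, ℝ)) (γ : SL(d + e + 1, ℤ)) : primTsum f (g * slInt γ) = primTsum f g := by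
  simp only [primTsum, applyInt_mul_slInt]
  exact (primIntPerm γ).tsum_eq fun u : primInt d e => f (applyInt g.1 u.1)

theorem lintegral_primTsum {f : (Fin d → Fin (d + e + 1) → ℝ) → ℝ≥0∞} (hf : Measurable f) :
    ∫⁻ g, slWeight g * primTsum f g ∂slHaar (Fin.last (d + e)) =
      (∫⁻ v, f v) * slCovolume (Fin.last e) := by
  let E : Fin d ⊕ Fin (e + 1) ≃ Fin (d + e + 1) := finSumFinEquiv
  have hE := volume_preserving_comp_symm (ι := Fin d) E
  calc ∫⁻ g, slWeight g * primTsum f g ∂slHaar (E (Sum.inr (Fin.last e)))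
      = ∫⁻ g, slWeight g * primTsum f (slReindex ℝ E g) ∂slHaar (Sum.inr (Fin.last e)) :=
        lintegral_slWeight_mul_slReindex E _ (measurable_primTsum hf) (primTsum_mul_slInt f)
    _ = ∫⁻ g : SpecialLinearGroup (Fin d ⊕ Fin (e + 1)) ℝ, slWeight g *
          ∑' u : intPrimitive (Fin d) (Fin (e + 1)),
            f (fun i y => applyInt g.1 u.1 i (E.symm y)) ∂slHaar (Sum.inr (Fin.last e)) := by
        simp only [primTsum, applyInt_slReindex]
        exact lintegral_congr fun g => congrArg _ ((primIntEquivIntPrimitive d e).tsum_eq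
          fun u => f fun i y => applyInt g.1 u.1 i (E.symm y))
    _ = (∫⁻ v, f v) * slCovolume (Fin.last e) := by
        rw [← hE.lintegral_comp hf]
        exact lintegral_tsum_intPrimitive (Fin.last e) (hf.comp hE.measurable)

end PrimitiveTuples

section LatticeSpaceMeasure

open ProbabilityTheory

variable {k : ℕ}

theorem slInt_mem_integerSL (γ : SL(k, ℤ)) : slInt γ ∈ integerSL k := ⟨γ, rfl⟩

theorem mem_integerSL_iff {g : SL(k, ℝ)} :
    g ∈ integerSL k ↔ ∀ i j, g.1 i j ∈ range (Int.cast : ℤ → ℝ) := by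
  refine ⟨?_, fun h => ?_⟩
  · rintro ⟨γ, rfl⟩ i j
    exact ⟨γ.1 i j, rfl⟩
  · choose A hA using h
    have hmap : (Int.castRingHom ℝ).mapMatrix (.of A) = g.1 := by
      ext i j
      exact hA i j
    have hdet : (Int.castRingHom ℝ) (Matrix.of A).det = 1 := by
      rw [RingHom.map_det, hmap, g.2]
    exact ⟨⟨.of A, Int.cast_injective (α := ℝ) (by simpa using hdet)⟩, Subtype.ext hmap⟩

theorem isClosed_integerSL : IsClosed (integerSL k : Set SL(k, ℝ)) := by
  have hinter : (integerSL k : Set SL(k, ℝ)) =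
      ⋂ i, ⋂ j, (fun g : SL(k, ℝ) => g.1 i j) ⁻¹' range (Int.cast : ℤ → ℝ) := by
    ext g
    simp only [SetLike.mem_coe, mem_integerSL_iff, mem_iInter, mem_preimage]
  rw [hinter]
  exact isClosed_iInter fun i => isClosed_iInter fun j =>
    Int.isClosedEmbedding_coe_real.isClosed_range.preimage (continuous_sl_apply i j)

/-- The projection of `SL_k(ℝ)` onto the space of lattices. -/
def toLattice (g : SL(k, ℝ)) : LatticeSpace k := QuotientGroup.mk g

theorem toLattice_surjective : Function.Surjective (toLattice (k := k)) :=
  QuotientGroup.mk_surjective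

theorem continuous_toLattice : Continuous (toLattice (k := k)) := QuotientGroup.continuous_mk

theorem toLattice_mul_slInt (g : SL(k, ℝ)) (γ : SL(k, ℤ)) :
    toLattice (g * slInt γ) = toLattice g :=
  QuotientGroup.mk_mul_of_mem g (slInt_mem_integerSL γ)

theorem exists_of_toLattice_eq {g h : SL(k, ℝ)} (H : toLattice g = toLattice h) :
    ∃ γ : SL(k, ℤ), h = g * slInt γ := by
  obtain ⟨γ, hγ⟩ := QuotientGroup.eq.1 H
  exact ⟨γ, eq_mul_of_inv_mul_eq hγ.symm⟩

theorem measurable_of_comp_toLattice {F : LatticeSpace k → ℝ≥0∞}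
    (hF : Measurable fun g => F (toLattice g)) : Measurable F := by
  have : IsClosed (integerSL k : Set SL(k, ℝ)) := isClosed_integerSL
  exact (continuous_toLattice.measurable.measurable_comp_iff_of_surjective
    toLattice_surjective).1 hF

theorem measurable_of_measurable_lintegral {α β : Type*} [MeasurableSpace α] [MeasurableSpace β]
    {κ : α → Measure β} (h : ∀ F : β → ℝ≥0∞, Measurable F → Measurable fun x => ∫⁻ y, F y ∂κ x) :
    Measurable κ :=
  Measure.measurable_of_measurable_coe κ fun s hs => by
    simpa only [lintegral_indicator_one hs] using h (s.indicator 1) (measurable_one.indicator hs)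

/-- The counting measure of the coset in `SL_k(ℝ)` that represents a lattice. -/
def cosetCount (x : LatticeSpace k) : Measure SL(k, ℝ) :=
  .sum fun γ : SL(k, ℤ) => .dirac (Quotient.out x * slInt γ)

theorem lintegral_cosetCount {F : SL(k, ℝ) → ℝ≥0∞} (hF : Measurable F) (g : SL(k, ℝ)) :
    ∫⁻ h, F h ∂cosetCount (toLattice g) = ∑' γ : SL(k, ℤ), F (g * slInt γ) := by
  obtain ⟨γ₀, hout⟩ := exists_of_toLattice_eq (QuotientGroup.out_eq' (toLattice g)).symm
  simp only [cosetCount, lintegral_sum_measure, lintegral_dirac' _ hF, hout]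
  exact tsum_mul_right_mul slInt F g γ₀

/-- `cosetCount` as a kernel. -/
def cosetKernel (k : ℕ) : Kernel (LatticeSpace k) SL(k, ℝ) where
  toFun := cosetCount
  measurable' := measurable_of_measurable_lintegral fun F hF =>
    measurable_of_comp_toLattice <| by
      simp only [lintegral_cosetCount hF]
      exact Measurable.tsum fun γ => hF.comp (measurable_mul_const _)

theorem lintegral_cosetKernel {F : SL(k, ℝ) → ℝ≥0∞} (hF : Measurable F) (g : SL(k, ℝ)) :
    ∫⁻ h, F h ∂cosetKernel k (toLattice g) = ∑' γ : SL(k, ℤ), F (g * slInt γ) :=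
  lintegral_cosetCount hF g

theorem lintegral_cosetKernel_smul {F : SL(k, ℝ) → ℝ≥0∞} (hF : Measurable F) (h : SL(k, ℝ))
    (x : LatticeSpace k) :
    ∫⁻ g, F g ∂cosetKernel k (h • x) = ∫⁻ g, F (h * g) ∂cosetKernel k x := by
  obtain ⟨g, rfl⟩ := toLattice_surjective x
  refine (lintegral_cosetKernel hF (h * g)).trans ?_
  simp only [mul_assoc]
  exact (lintegral_cosetKernel (hF.comp (measurable_const_mul h)) g).symm

theorem measurable_slWeight_mul_comp_toLattice {H : LatticeSpace k → ℝ≥0∞} (hH : Measurable H) :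
    Measurable fun g => slWeight g * H (toLattice g) :=
  isWeight_slWeight.measurable.mul (hH.comp continuous_toLattice.measurable)

theorem lintegral_slWeight_mul_cosetKernel {H : LatticeSpace k → ℝ≥0∞} (hH : Measurable H)
    (x : LatticeSpace k) : ∫⁻ g, slWeight g * H (toLattice g) ∂cosetKernel k x = H x := by
  obtain ⟨g, rfl⟩ := toLattice_surjective x
  rw [lintegral_cosetKernel (measurable_slWeight_mul_comp_toLattice hH)]
  simp only [toLattice_mul_slInt, ENNReal.tsum_mul_right, isWeight_slWeight.tsum_eq_one, one_mul]

section

variable (μ : Measure (LatticeSpace k))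

theorem isMulLeftInvariant_cosetKernel_comp [SMulInvariantMeasure SL(k, ℝ) (LatticeSpace k) μ] :
    (cosetKernel k ∘ₘ μ).IsMulLeftInvariant := by
  refine ⟨fun h => Measure.ext_of_lintegral _ fun F hF => ?_⟩
  have hFh : Measurable fun g => F (h * g) := hF.comp (measurable_const_mul h)
  rw [lintegral_map hF (measurable_const_mul h),
    Measure.lintegral_bind (by fun_prop) hFh.aemeasurable,
    Measure.lintegral_bind (by fun_prop) hF.aemeasurable,
    ← (measurePreserving_smul h μ).lintegral_comp hF.lintegral_kernel]
  exact lintegral_congr fun x => (lintegral_cosetKernel_smul hF h x).symm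

theorem sigmaFinite_cosetKernel_comp [IsFiniteMeasure μ] : SigmaFinite (cosetKernel k ∘ₘ μ) := by
  have hw := isWeight_slWeight (n := Fin k)
  have hfin : IsFiniteMeasure ((cosetKernel k ∘ₘ μ).withDensity slWeight) := by
    refine isFiniteMeasure_withDensity ?_
    rw [Measure.lintegral_bind (by fun_prop) hw.measurable.aemeasurable]
    have hone (x : LatticeSpace k) : ∫⁻ g, slWeight g ∂cosetKernel k x = 1 := by
      simpa using lintegral_slWeight_mul_cosetKernel measurable_one x
    simp [hone]
  rw [← withDensity_inv_same (μ := cosetKernel k ∘ₘ μ) hw.measurable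
    (.of_forall fun g => (hw.pos g).ne')
    (.of_forall fun g => ((hw.le_one g).trans_lt ENNReal.one_lt_top).ne)]
  exact .withDensity_of_ne_top (.of_forall fun g => ENNReal.inv_ne_top.2 (hw.pos g).ne')

end

/-- The invariant measure on the space of lattices induced by `slHaar j`, not normalized. -/
def quotientHaar (j : Fin k) : Measure (LatticeSpace k) :=
  ((slHaar j).withDensity slWeight).map toLattice

theorem lintegral_quotientHaar (j : Fin k) {H : LatticeSpace k → ℝ≥0∞} (hH : Measurable H) :
    ∫⁻ x, H x ∂quotientHaar j = ∫⁻ g, slWeight g * H (toLattice g) ∂slHaar j :=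
  (lintegral_map hH continuous_toLattice.measurable).trans <|
    lintegral_withDensity_eq_lintegral_mul _ isWeight_slWeight.measurable
      (hH.comp continuous_toLattice.measurable)

theorem quotientHaar_univ (j : Fin k) : quotientHaar j univ = slCovolume j := by
  rw [← lintegral_one, lintegral_quotientHaar j measurable_const]
  simp only [mul_one, slCovolume]

theorem lintegral_smul_quotientHaar (j : Fin k) (h : SL(k, ℝ)) {H : LatticeSpace k → ℝ≥0∞}
    (hH : Measurable H) : ∫⁻ x, H (h • x) ∂quotientHaar j = ∫⁻ x, H x ∂quotientHaar j := by
  have hw := isWeight_slWeight (n := Fin k)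
  have hw' : IsWeight slInt fun g : SL(k, ℝ) => slWeight (h⁻¹ * g) :=
    { measurable := hw.measurable.comp (measurable_const_mul _)
      pos := fun g => hw.pos _
      tsum_eq_one := fun g => by simpa only [mul_assoc] using hw.tsum_eq_one (h⁻¹ * g) }
  calc ∫⁻ x, H (h • x) ∂quotientHaar j
      = ∫⁻ g, slWeight (h⁻¹ * (h * g)) * H (toLattice (h * g)) ∂slHaar j := by
        simp only [inv_mul_cancel_left]
        exact lintegral_quotientHaar j (hH.comp (measurable_const_smul h))
    _ = ∫⁻ g, slWeight (h⁻¹ * g) * H (toLattice g) ∂slHaar j :=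
        lintegral_mul_left_eq_self (fun g => slWeight (h⁻¹ * g) * H (toLattice g)) h
    _ = ∫⁻ g, slWeight g * H (toLattice g) ∂slHaar j :=
        hw'.lintegral_mul_eq_lintegral_mul hw (hH.comp continuous_toLattice.measurable)
          fun g γ => congrArg H (toLattice_mul_slInt g γ)
    _ = ∫⁻ x, H x ∂quotientHaar j := (lintegral_quotientHaar j hH).symm

instance smulInvariantMeasure_quotientHaar (j : Fin k) :
    SMulInvariantMeasure SL(k, ℝ) (LatticeSpace k) (quotientHaar j) where
  measure_preimage_smul h s hs := by
    rw [← lintegral_indicator_one (measurable_const_smul h hs), ← lintegral_indicator_one hs]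
    exact lintegral_smul_quotientHaar j h (measurable_one.indicator hs)

theorem exists_isNormalizedHaar {j : Fin k} (hj : slCovolume j ≠ ∞) :
    ∃ μ : Measure (LatticeSpace k), IsNormalizedHaar μ := by
  refine ⟨(slCovolume j)⁻¹ • quotientHaar j, ⟨⟨?_⟩, inferInstance⟩⟩
  rw [Measure.smul_apply, quotientHaar_univ, smul_eq_mul,
    ENNReal.inv_mul_cancel (slCovolume_ne_zero j) hj]

theorem IsNormalizedHaar.eq_smul_quotientHaar {μ : Measure (LatticeSpace k)}
    (hμ : IsNormalizedHaar μ) (j : Fin k) : μ = (slCovolume j)⁻¹ • quotientHaar j := by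
  have := hμ.isProbabilityMeasure
  have := hμ.smulInvariant
  have := isMulLeftInvariant_cosetKernel_comp μ
  have := sigmaFinite_cosetKernel_comp μ
  obtain ⟨c, hc⟩ := exists_eq_smul_of_isMulLeftInvariant (m' := cosetKernel k ∘ₘ μ)
    (slHaar_ne_zero j)
  have hμc : μ = c • quotientHaar j := by
    refine Measure.ext_of_lintegral _ fun H hH => ?_
    rw [lintegral_smul_measure, lintegral_quotientHaar j hH, ← lintegral_smul_measure, ← hc,
      Measure.lintegral_bind (by fun_prop)
        (measurable_slWeight_mul_comp_toLattice hH).aemeasurable]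
    exact lintegral_congr fun x => (lintegral_slWeight_mul_cosetKernel hH x).symm
  have hone : c * slCovolume j = 1 := by
    rw [← quotientHaar_univ, ← smul_eq_mul, ← Measure.smul_apply, ← hμc, measure_univ]
  rwa [← ENNReal.eq_inv_of_mul_eq_one_left hone]

end LatticeSpaceMeasure

section IntegralBases

theorem exists_specialLinearGroup_eq_of_ne {n R : Type*} [Fintype n] [DecidableEq n] [CommRing R]
    {M : Matrix n n R} (hM : IsUnit M.det) (j : n) :
    ∃ γ : SpecialLinearGroup n R, ∀ l, ∀ x ≠ j, γ.1 l x = M l x := by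
  refine ⟨⟨M.updateCol j (Ring.inverse M.det • M.col j), ?_⟩, fun l x hx => updateCol_ne hx⟩
  rw [det_updateCol_smul, show M.updateCol j (M.col j) = M from updateCol_eq_self M j,
    Ring.inverse_mul_cancel _ hM]

variable {d e : ℕ}

theorem basis_comp_mem_primInt (b : Basis (Fin (d + e + 1)) ℤ (Fin (d + e + 1) → ℤ))
    (ε : Fin d ↪ Fin (d + e + 1)) : (fun i => b (ε i)) ∈ primInt d e := by
  obtain ⟨σ, hσ⟩ := Equiv.Perm.exists_extending_pair (Fin.castAdd (n := d) (e + 1)) ε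
    (Fin.castAdd_injective d (e + 1)) ε.injective
  have hdet : IsUnit ((Pi.basisFun ℤ _).toMatrix (b.reindex σ.symm)).det := by
    rw [← Basis.det_apply]
    exact Basis.isUnit_det _ _
  obtain ⟨γ, hγ⟩ := exists_specialLinearGroup_eq_of_ne hdet (Fin.last (d + e))
  refine ⟨γ, funext fun i => funext fun l => (hγ l _ (Fin.ne_of_lt ?_)).trans ?_⟩
  · exact Fin.lt_def.2 (i.2.trans_le (Nat.le_add_right d e))
  · simp [Basis.toMatrix_apply, hσ]

theorem exists_dual_apply_eq_one {u : Fin 1 → Fin (1 + e + 1) → ℤ} (hu : u ∈ primInt 1 e) :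
    ∃ φ : Dual ℤ (Fin (1 + e + 1) → ℤ), φ (u 0) = 1 := by
  obtain ⟨γ, rfl⟩ := hu
  let c : Fin (1 + e + 1) := Fin.castAdd (e + 1) 0
  refine ⟨LinearMap.proj c ∘ₗ (γ⁻¹).1.mulVecLin, ?_⟩
  calc ((γ⁻¹).1 * γ.1) c c = (γ⁻¹ * γ).1 c c := rfl
    _ = 1 := by rw [inv_mul_cancel, Matrix.SpecialLinearGroup.coe_one, one_apply_eq]

theorem dvd_of_smul_eq_smul_primInt {u u' : Fin 1 → Fin (1 + e + 1) → ℤ} (hu' : u' ∈ primInt 1 e)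
    {m m' : ℤ} (h : m • u 0 = m' • u' 0) : m ∣ m' := by
  obtain ⟨φ, hφ⟩ := exists_dual_apply_eq_one hu'
  refine ⟨φ (u 0), ?_⟩
  rw [← smul_eq_mul, ← map_smul, h, map_smul, hφ, smul_eq_mul, mul_one]

theorem exists_basis_smul_eq {ι : Type*} [Finite ι] {z : ι → ℤ} (hz : z ≠ 0) :
    ∃ (b : Basis ι ℤ (ι → ℤ)) (i : ι) (t : ℕ), (t : ℤ) • b i = z := by
  obtain ⟨n, S⟩ := Submodule.smithNormalForm (Pi.basisFun ℤ ι) (ℤ ∙ z)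
  obtain rfl : n = 1 := by
    have hrank := (LinearEquiv.toSpanNonzeroSingleton ℤ (ι → ℤ) z hz).finrank_eq
    rw [finrank_self, finrank_eq_card_basis S.bN, Fintype.card_fin] at hrank
    exact hrank.symm
  obtain ⟨t, ht⟩ : ∃ t : ℤ, t • S.bM (S.f 0) = z := by
    have hsum := congrArg Subtype.val (S.bN.sum_repr ⟨z, Submodule.mem_span_singleton_self z⟩)
    rw [Fin.sum_univ_one, Submodule.coe_smul, S.snf, smul_smul] at hsum
    exact ⟨_, hsum⟩
  rcases Int.natAbs_eq t with htabs | htabs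
  · exact ⟨S.bM, S.f 0, t.natAbs, by rw [← htabs, ht]⟩
  · refine ⟨S.bM.map (LinearEquiv.neg ℤ), S.f 0, t.natAbs, ?_⟩
    rw [Basis.map_apply, LinearEquiv.neg_apply, smul_neg, ← neg_smul, ← htabs, ht]

/-- The positive multiples of integral primitive vectors; they are the nonzero integral vectors,
each one obtained once. -/
def smulPrimInt (p : ℕ × primInt 1 e) : Fin (1 + e + 1) → ℤ := ((p.1 + 1 : ℕ) : ℤ) • p.2.1 0

theorem smulPrimInt_injective : Function.Injective (smulPrimInt (e := e)) := by
  rintro ⟨m, u, hu⟩ ⟨m', u', hu'⟩ (h : ((m + 1 : ℕ) : ℤ) • u 0 = ((m' + 1 : ℕ) : ℤ) • u' 0)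
  obtain rfl : m = m' := Nat.succ_injective <| Nat.dvd_antisymm
    (Int.natCast_dvd_natCast.1 (dvd_of_smul_eq_smul_primInt hu' h))
    (Int.natCast_dvd_natCast.1 (dvd_of_smul_eq_smul_primInt hu h.symm))
  obtain rfl : u = u' := funext fun i => by
    rw [Subsingleton.elim i 0]
    exact smul_right_injective _ (Nat.cast_ne_zero.2 m.succ_ne_zero) h
  rfl

theorem range_smulPrimInt : range (smulPrimInt (e := e)) = {0}ᶜ := by
  ext z
  constructor
  · rintro ⟨⟨m, u, hu⟩, rfl⟩
    obtain ⟨φ, hφ⟩ := exists_dual_apply_eq_one hu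
    have hu0 : u 0 ≠ 0 := fun h => zero_ne_one (α := ℤ) (by rw [← hφ, h, map_zero])
    exact smul_ne_zero (Nat.cast_ne_zero.2 m.succ_ne_zero) hu0
  · intro hz
    obtain ⟨b, i, t, ht⟩ := exists_basis_smul_eq hz
    obtain ⟨m, rfl⟩ : ∃ m, t = m + 1 := Nat.exists_eq_succ_of_ne_zero <| by
      rintro rfl
      exact hz (by rw [← ht, Nat.cast_zero, zero_smul, mem_singleton_iff])
    have hmem := basis_comp_mem_primInt b
      ⟨fun _ : Fin 1 => i, Function.injective_of_subsingleton _⟩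
    exact ⟨(m, ⟨_, hmem⟩), ht⟩

end IntegralBases

section Lattice

variable {k : ℕ}

theorem lattice_toLattice (g : SL(k, ℝ)) : (toLattice g).lattice = matrixLattice g := rfl

/-- The map `ℤ^k → ℝ^k` given by a real matrix. -/
def latticeMap (g : SL(k, ℝ)) : (Fin k → ℤ) →ₗ[ℤ] (Fin k → ℝ) :=
  Fintype.linearCombination ℤ g.1.col

theorem latticeMap_apply (g : SL(k, ℝ)) (z : Fin k → ℤ) :
    latticeMap g z = g.1 *ᵥ fun l => (z l : ℝ) := by
  funext l
  simp [latticeMap, Fintype.linearCombination_apply, Matrix.mulVec, dotProduct, mul_comm]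

theorem mulVec_injective_of_sl {n R : Type*} [Fintype n] [DecidableEq n] [CommRing R]
    (g : SpecialLinearGroup n R) : Function.Injective g.1.mulVec :=
  Matrix.mulVec_injective_of_isUnit <| (Matrix.isUnit_iff_isUnit_det _).2 (g.2.symm ▸ isUnit_one)

theorem latticeMap_injective (g : SL(k, ℝ)) : Function.Injective (latticeMap g) := by
  intro z z' h
  rw [latticeMap_apply, latticeMap_apply] at h
  exact funext fun l => Int.cast_injective (congrFun (mulVec_injective_of_sl g h) l)

/-- The isomorphism of `ℤ^k` with the lattice `g ℤ^k`. -/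
def latticeEquiv (g : SL(k, ℝ)) : (Fin k → ℤ) ≃ₗ[ℤ] matrixLattice g :=
  (LinearEquiv.ofInjective (latticeMap g) (latticeMap_injective g)).trans
    (LinearEquiv.ofEq _ _ (Fintype.range_linearCombination ℤ _))

theorem coe_latticeEquiv (g : SL(k, ℝ)) (z : Fin k → ℤ) :
    (latticeEquiv g z : Fin k → ℝ) = latticeMap g z := rfl

theorem applyInt_eq_latticeMap {ι : Type*} (g : SL(k, ℝ)) (u : ι → Fin k → ℤ) :
    applyInt g.1 u = fun i => latticeMap g (u i) :=
  funext fun i => (latticeMap_apply g (u i)).symm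

theorem applyInt_injective {ι : Type*} (g : SL(k, ℝ)) :
    Function.Injective (applyInt (ι := ι) g.1) := by
  intro u u' h
  rw [applyInt_eq_latticeMap, applyInt_eq_latticeMap] at h
  exact funext fun i => latticeMap_injective g (congrFun h i)

theorem primitiveTuples_matrixLattice {d e : ℕ} (g : SL(d + e + 1, ℝ)) :
    primitiveTuples d (matrixLattice g) = applyInt g.1 '' primInt d e := by
  ext v
  constructor
  · rintro ⟨b, ε, hb⟩
    refine ⟨_, basis_comp_mem_primInt (b.map (latticeEquiv g).symm) ε, ?_⟩
    rw [applyInt_eq_latticeMap]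
    funext i
    rw [← coe_latticeEquiv, Basis.map_apply, LinearEquiv.apply_symm_apply, hb]
  · rintro ⟨_, ⟨γ, rfl⟩, rfl⟩
    refine ⟨((Pi.basisFun ℤ _).map (Matrix.SpecialLinearGroup.toLin' γ)).map (latticeEquiv g),
      ⟨Fin.castAdd (e + 1), Fin.castAdd_injective d (e + 1)⟩, fun i => ?_⟩
    rw [applyInt_eq_latticeMap, Basis.map_apply, coe_latticeEquiv]
    refine congrArg (latticeMap g) (funext fun l => ?_)
    simp [Matrix.SpecialLinearGroup.toLin'_apply]

end Lattice

section PrimitiveKernel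

open ProbabilityTheory

variable {d e : ℕ}

theorem countable_primitiveTuples (x : LatticeSpace (d + e + 1)) :
    (primitiveTuples d x.lattice).Countable := by
  obtain ⟨g, rfl⟩ := toLattice_surjective x
  rw [lattice_toLattice, primitiveTuples_matrixLattice]
  exact (countable_range _).image _

theorem lintegral_restrict_count {α : Type*} [MeasurableSpace α] [MeasurableSingletonClass α]
    {s : Set α} (hs : s.Countable) (f : α → ℝ≥0∞) :
    ∫⁻ a in s, f a ∂Measure.count = ∑' a : s, f a := by
  simp only [lintegral_countable f hs, Measure.count_singleton, mul_one]

theorem lintegral_count_primitiveTuples (f : (Fin d → Fin (d + e + 1) → ℝ) → ℝ≥0∞)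
    (g : SL(d + e + 1, ℝ)) :
    ∫⁻ v in primitiveTuples d (toLattice g).lattice, f v ∂Measure.count = primTsum f g := by
  rw [lintegral_restrict_count (countable_primitiveTuples _), lattice_toLattice,
    primitiveTuples_matrixLattice, tsum_image f (applyInt_injective g).injOn]
  rfl

/-- The kernel sending a lattice to the counting measure of its set of primitive tuples. -/
def primitiveKernel (d e : ℕ) :
    Kernel (LatticeSpace (d + e + 1)) (Fin d → Fin (d + e + 1) → ℝ) where
  toFun x := Measure.count.restrict (primitiveTuples d x.lattice)
  measurable' := measurable_of_measurable_lintegral fun f hf =>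
    measurable_of_comp_toLattice <| by
      simp only [lintegral_count_primitiveTuples]
      exact measurable_primTsum hf

theorem primitiveKernel_apply (x : LatticeSpace (d + e + 1)) :
    primitiveKernel d e x = Measure.count.restrict (primitiveTuples d x.lattice) := rfl

theorem lintegral_primitiveKernel (f : (Fin d → Fin (d + e + 1) → ℝ) → ℝ≥0∞)
    (g : SL(d + e + 1, ℝ)) : ∫⁻ v, f v ∂primitiveKernel d e (toLattice g) = primTsum f g :=
  lintegral_count_primitiveTuples f g

/-- The constant of the mean value formula for primitive `d`-tuples in dimension `d + e + 1`. -/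
def meanConst (d e : ℕ) : ℝ≥0∞ := slCovolume (Fin.last e) / slCovolume (Fin.last (d + e))

theorem IsNormalizedHaar.primitiveKernel_comp {μ : Measure (LatticeSpace (d + e + 1))}
    (hμ : IsNormalizedHaar μ) : primitiveKernel d e ∘ₘ μ = meanConst d e • volume := by
  refine Measure.ext_of_lintegral _ fun f hf => ?_
  rw [Measure.lintegral_bind (by fun_prop) hf.aemeasurable, hμ.eq_smul_quotientHaar (Fin.last _),
    lintegral_smul_measure, lintegral_quotientHaar _ hf.lintegral_kernel, lintegral_smul_measure]
  simp only [lintegral_primitiveKernel, lintegral_primTsum hf, smul_eq_mul, meanConst,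
    ENNReal.div_eq_inv_mul]
  ring

end PrimitiveKernel

section CubeCount

open Filter Metric
open scoped Topology

variable {ι : Type*} [Fintype ι] (L : Submodule ℤ (ι → ℝ))

/-- The number of points of `L` in the cube `[-R, R]^ι`, the closed ball of the sup norm. -/
def cubeCount (R : ℝ) : ℝ≥0∞ := ((L : Set (ι → ℝ)) ∩ closedBall 0 R).encard

theorem tsum_indicator_closedBall (R : ℝ) :
    ∑' v : L, (closedBall (0 : ι → ℝ) R).indicator (1 : (ι → ℝ) → ℝ≥0∞) v = cubeCount L R := by
  calc _ = ∑' v : ι → ℝ, (L : Set (ι → ℝ)).indicator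
        ((closedBall (0 : ι → ℝ) R).indicator (1 : (ι → ℝ) → ℝ≥0∞)) v :=
        tsum_subtype (L : Set (ι → ℝ)) _
    _ = _ := by rw [indicator_indicator, ← tsum_subtype, cubeCount, ← ENNReal.tsum_set_one]; rfl

theorem mem_closedBall_zero_pi_iff {R : ℝ} (hR : 0 ≤ R) {v : ι → ℝ} :
    v ∈ closedBall 0 R ↔ ∀ i, |v i| ≤ R := by
  rw [mem_closedBall_zero_iff, pi_norm_le_iff_of_nonneg hR]
  rfl

theorem encard_floor_class_le (a : ι → ℤ) :
    {v | v ∈ L ∧ ∀ i, ⌊v i⌋ = a i}.encard ≤ ((L : Set (ι → ℝ)) ∩ closedBall 0 1).encard := by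
  obtain h | ⟨v₀, hv₀, hv₀a⟩ := {v | v ∈ L ∧ ∀ i, ⌊v i⌋ = a i}.eq_empty_or_nonempty
  · rw [h, encard_empty]
    exact zero_le
  · refine encard_le_encard_of_injOn (f := fun v => v - v₀) ?_ (sub_left_injective.injOn)
    rintro v ⟨hv, hva⟩
    refine ⟨L.sub_mem hv hv₀, (mem_closedBall_zero_pi_iff zero_le_one).2 fun i => ?_⟩
    exact (Int.abs_sub_lt_one_of_floor_eq_floor ((hva i).trans (hv₀a i).symm)).le

theorem inter_closedBall_subset_iUnion_floor_class [DecidableEq ι] (n : ℕ) :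
    (L : Set (ι → ℝ)) ∩ closedBall 0 n ⊆
      ⋃ a ∈ Fintype.piFinset fun _ : ι => Finset.Icc (-(n : ℤ)) n,
        {v | v ∈ L ∧ ∀ i, ⌊v i⌋ = a i} := by
  rintro v ⟨hv, hvn⟩
  refine mem_biUnion (x := fun i => ⌊v i⌋) ?_ ⟨hv, fun _ => rfl⟩
  rw [Finset.mem_coe, Fintype.mem_piFinset]
  intro i
  have hvi := abs_le.1 ((mem_closedBall_zero_pi_iff n.cast_nonneg).1 hvn i)
  exact Finset.mem_Icc.2 ⟨Int.le_floor.2 (by exact_mod_cast hvi.1),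
    Int.floor_le_iff.2 (hvi.2.trans_lt (by push_cast; exact lt_add_one _))⟩

theorem cubeCount_natCast_le (n : ℕ) :
    cubeCount L n ≤ (2 * n + 1) ^ Fintype.card ι * cubeCount L 1 := by
  classical
  have hcard : (n + 1 + n : ℤ).toNat = 2 * n + 1 := by omega
  have h := (encard_le_encard (inter_closedBall_subset_iUnion_floor_class L n)).trans <|
    (Finset.set_encard_biUnion_le _ _).trans <|
      Finset.sum_le_card_nsmul _ _ _ fun a _ => encard_floor_class_le L a
  simpa [cubeCount, Fintype.card_piFinset, hcard] using ENat.toENNReal_le.2 h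

variable [DiscreteTopology L]

theorem cubeCount_eq_natCard (R : ℝ) :
    cubeCount L R = Nat.card (closedBall 0 R ∩ L : Set (ι → ℝ)) := by
  have : DiscreteTopology L.toAddSubgroup := inferInstanceAs (DiscreteTopology L)
  have hfin : (closedBall 0 R ∩ L : Set (ι → ℝ)).Finite :=
    finite_isBounded_inter_isClosed DiscreteTopology.isDiscrete isBounded_closedBall
      (AddSubgroup.isClosed_of_discrete (H := L.toAddSubgroup))
  rw [cubeCount, inter_comm, ← hfin.cast_ncard_eq, ENat.toENNReal_coe, Nat.card_coe_set_eq]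

variable [IsZLattice ℝ L]

theorem tendsto_natCard_closedBall_inter_div_pow [Nonempty ι] :
    Tendsto (fun R : ℝ => (Nat.card (closedBall 0 R ∩ L : Set (ι → ℝ)) : ℝ) / R ^ Fintype.card ι)
      atTop (𝓝 (2 ^ Fintype.card ι / ZLattice.covolume L)) := by
  have hball {R : ℝ} (hR : 0 ≤ R) :
      {x : ι → ℝ | x ∈ univ ∧ ‖x‖ ^ Fintype.card ι ≤ R ^ Fintype.card ι} = closedBall 0 R := by
    ext x
    simp [pow_le_pow_iff_left₀ (norm_nonneg x) hR Fintype.card_ne_zero]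
  have hunit : {x : ι → ℝ | x ∈ univ ∧ ‖x‖ ^ Fintype.card ι ≤ 1} = closedBall 0 1 := by
    rw [← hball zero_le_one, one_pow]
  have hlim := (ZLattice.covolume.tendsto_card_le_div L (X := univ)
    (F := fun x => ‖x‖ ^ Fintype.card ι) (fun _ _ _ _ => mem_univ _)
    (fun x r hr => by rw [norm_smul, mul_pow, Real.norm_of_nonneg hr])
    (hunit ▸ isBounded_closedBall) (hunit ▸ isClosed_closedBall.measurableSet)
    (hunit ▸ (convex_closedBall 0 1).addHaar_frontier volume)).comp
    (tendsto_pow_atTop (Fintype.card_ne_zero (α := ι)))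
  rw [hunit, Measure.real, Real.volume_pi_closedBall _ zero_le_one] at hlim
  refine (hlim.congr' ?_).trans_eq (by simp)
  filter_upwards [eventually_ge_atTop 0] with R hR
  simp only [Function.comp_apply, hball hR]

theorem tendsto_cubeCount_div_pow [Nonempty ι] (hL : ZLattice.covolume L = 1) :
    Tendsto (fun n : ℕ => cubeCount L n / (n : ℝ≥0∞) ^ Fintype.card ι) atTop
      (𝓝 (2 ^ Fintype.card ι)) := by
  have hlim := (ENNReal.continuous_ofReal.tendsto _).comp <|
    (tendsto_natCard_closedBall_inter_div_pow L).comp tendsto_natCast_atTop_atTop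
  rw [hL, div_one, ENNReal.ofReal_pow zero_le_two, ENNReal.ofReal_ofNat] at hlim
  refine hlim.congr' ?_
  filter_upwards [eventually_gt_atTop 0] with n hn
  have hn' : (0 : ℝ) < n := Nat.cast_pos.2 hn
  simp only [Function.comp_apply, cubeCount_eq_natCard, ENNReal.ofReal_div_of_pos (pow_pos hn' _),
    ENNReal.ofReal_pow hn'.le, ENNReal.ofReal_natCast]

theorem exists_ne_zero_mem_closedBall_one [Nonempty ι] (hL : ZLattice.covolume L ≤ 1) :
    ∃ v ∈ L, v ≠ 0 ∧ v ∈ closedBall 0 1 := by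
  have : Countable L.toAddSubgroup := inferInstanceAs (Countable L)
  have : DiscreteTopology L.toAddSubgroup := inferInstanceAs (DiscreteTopology L)
  let b := Free.chooseBasis ℤ L
  have hF := ZLattice.isAddFundamentalDomain b volume
  have hvol : volume (ZSpan.fundamentalDomain (b.ofZLatticeBasis ℝ L)) ≤ 1 := by
    rw [ZLattice.covolume_eq_measure_fundamentalDomain L volume hF] at hL
    refine (ENNReal.toReal_le_toReal ?_ ENNReal.one_ne_top).1 (hL.trans_eq ENNReal.toReal_one.symm)
    exact (ZSpan.fundamentalDomain_isBounded _).measure_lt_top.ne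
  obtain ⟨v, hv0, hv⟩ := exists_ne_zero_mem_lattice_of_measure_mul_two_pow_le_measure
    (L := L.toAddSubgroup) (s := closedBall 0 1) hF (fun v hv => by simpa using hv)
    (convex_closedBall 0 1) (isCompact_closedBall 0 1) (by
      simpa [Real.volume_pi_closedBall _ zero_le_one] using mul_le_of_le_one_left' hvol)
  exact ⟨v, v.2, fun h => hv0 (Subtype.ext h), hv⟩

end CubeCount

section UnimodularLattice

variable {k : ℕ} (g : SL(k, ℝ))

theorem matrixLattice_eq_span_basis : matrixLattice g = Submodule.span ℤ
    (range ((Pi.basisFun ℝ (Fin k)).map (Matrix.SpecialLinearGroup.toLin' g))) := by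
  refine congrArg (fun s => Submodule.span ℤ (range s)) (funext fun i => funext fun l => ?_)
  simp [Matrix.SpecialLinearGroup.toLin'_apply]

instance instDiscreteTopologyMatrixLattice : DiscreteTopology (matrixLattice g) :=
  matrixLattice_eq_span_basis g ▸ inferInstance

instance instIsZLatticeMatrixLattice : IsZLattice ℝ (matrixLattice g) where
  span_top := by
    rw [matrixLattice_eq_span_basis]
    exact ZSpan.span_top _

theorem covolume_matrixLattice : ZLattice.covolume (matrixLattice g) = 1 := by
  rw [ZLattice.covolume_eq_det _ ((Pi.basisFun ℤ (Fin k)).map (latticeEquiv g))]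
  have : Matrix.of (Subtype.val ∘ (Pi.basisFun ℤ (Fin k)).map (latticeEquiv g)) = g.1ᵀ := by
    ext i l
    simp [coe_latticeEquiv, latticeMap]
  rw [this, det_transpose, g.2, abs_one]

end UnimodularLattice

section FiniteCovolume

variable {e : ℕ}

theorem exists_ne_zero_latticeMap_mem_closedBall {k : ℕ} [NeZero k] (g : SL(k, ℝ)) :
    ∃ z ≠ 0, latticeMap g z ∈ Metric.closedBall 0 1 := by
  obtain ⟨v, hv, hv0, hv1⟩ :=
    exists_ne_zero_mem_closedBall_one (matrixLattice g) (covolume_matrixLattice g).le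
  obtain ⟨z, hz⟩ := (latticeEquiv g).surjective ⟨v, hv⟩
  obtain rfl : latticeMap g z = v := congrArg Subtype.val hz
  exact ⟨z, fun h => hv0 (h ▸ map_zero _), hv1⟩

/-- Minkowski's theorem gives a short vector of the lattice; dividing it by its content makes it
primitive and no longer. -/
theorem one_le_primTsum (g : SL(1 + e + 1, ℝ)) :
    1 ≤ primTsum (d := 1) ((Metric.closedBall 0 1).indicator 1) g := by
  obtain ⟨z, hz0, hz⟩ := exists_ne_zero_latticeMap_mem_closedBall g
  obtain ⟨⟨m, u⟩, rfl⟩ := range_smulPrimInt.symm.subset hz0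
  have hu : latticeMap g (u.1 0) ∈ Metric.closedBall 0 1 := by
    rw [smulPrimInt, map_smul, mem_closedBall_zero_iff, ← Int.cast_smul_eq_zsmul ℝ,
      norm_smul] at hz
    refine mem_closedBall_zero_iff.2 ((le_mul_of_one_le_left (norm_nonneg _) ?_).trans hz)
    rw [Int.cast_natCast, Real.norm_natCast, Nat.one_le_cast]
    exact Nat.le_add_left 1 m
  have hball : applyInt g.1 u.1 ∈ Metric.closedBall 0 1 := by
    rw [applyInt_eq_latticeMap, mem_closedBall_zero_iff, pi_norm_le_iff_of_nonneg zero_le_one]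
    exact fun i => Subsingleton.elim i 0 ▸ mem_closedBall_zero_iff.1 hu
  calc (1 : ℝ≥0∞) = (Metric.closedBall 0 1).indicator 1 (applyInt g.1 u.1) :=
        (indicator_of_mem hball 1).symm
    _ ≤ _ := ENNReal.le_tsum u

theorem slCovolume_succ_le (e : ℕ) : slCovolume (Fin.last (1 + e)) ≤
    volume (Metric.closedBall (0 : Fin 1 → Fin (1 + e + 1) → ℝ) 1) * slCovolume (Fin.last e) := by
  have hball : MeasurableSet (Metric.closedBall (0 : Fin 1 → Fin (1 + e + 1) → ℝ) 1) :=
    Metric.isClosed_closedBall.measurableSet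
  rw [← lintegral_indicator_one hball, ← lintegral_primTsum (measurable_one.indicator hball),
    slCovolume]
  exact lintegral_mono fun g => le_mul_of_one_le_right zero_le (one_le_primTsum g)

theorem slCovolume_ne_top (e : ℕ) : slCovolume (Fin.last e) ≠ ∞ := by
  induction e with
  | zero =>
    have hbox : slBox (n := Fin (0 + 1)) 1 = univ := by
      refine eq_univ_of_forall fun g i j => ?_
      have : Subsingleton (Fin (0 + 1)) := inferInstanceAs (Subsingleton (Fin 1))
      rw [Subsingleton.elim g 1, Subsingleton.elim i j, Matrix.SpecialLinearGroup.coe_one]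
      simp
    refine ne_top_of_le_ne_top ((ColumnScaling.single (Fin.last 0)).haar_slBox_lt_top 1).ne ?_
    rw [hbox, ← lintegral_one]
    exact lintegral_mono fun g => isWeight_slWeight.le_one g
  | succ e ih =>
    rw [← Nat.add_comm 1 e]
    exact ne_top_of_le_ne_top (ENNReal.mul_ne_top measure_closedBall_lt_top.ne ih)
      (slCovolume_succ_le e)

end FiniteCovolume

section SiegelFormula

variable {e : ℕ}

/-- The value of the Riemann zeta function at the integer `k`, as a sum in `[0, ∞]`. -/
def zetaSum (k : ℕ) : ℝ≥0∞ := ∑' m : ℕ, ENNReal.ofReal (1 / ((m + 1 : ℕ) : ℝ) ^ k)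

theorem summable_one_div_succ_pow {k : ℕ} (hk : 1 < k) :
    Summable fun m : ℕ => 1 / ((m + 1 : ℕ) : ℝ) ^ k :=
  (summable_nat_add_iff (f := fun n : ℕ => 1 / (n : ℝ) ^ k) 1).2
    (Real.summable_one_div_nat_pow.2 hk)

theorem zetaSum_ne_top {k : ℕ} (hk : 1 < k) : zetaSum k ≠ ∞ :=
  (summable_one_div_succ_pow hk).tsum_ofReal_ne_top

theorem riemannZeta_eq_zetaSum {k : ℕ} (hk : 1 < k) :
    riemannZeta k = ((zetaSum k).toReal : ℂ) := by
  have hzeta := (Real.summable_one_div_nat_pow.2 hk).tsum_eq_zero_add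
  rw [Nat.cast_zero, zero_pow (by omega), div_zero, zero_add] at hzeta
  rw [zeta_nat_eq_tsum_of_gt_one hk, zetaSum,
    ← ENNReal.ofReal_tsum_of_nonneg (fun m => by positivity) (summable_one_div_succ_pow hk),
    ENNReal.toReal_ofReal (tsum_nonneg fun m => by positivity), ← hzeta]
  push_cast
  rfl

theorem lintegral_comp_smul {E : Type*} [NormedAddCommGroup E] [NormedSpace ℝ E]
    [MeasurableSpace E] [BorelSpace E] [FiniteDimensional ℝ E] (μ : Measure E)
    [μ.IsAddHaarMeasure] {f : E → ℝ≥0∞} (hf : Measurable f) {r : ℝ} (hr : 0 < r) :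
    ∫⁻ x, f (r • x) ∂μ = ENNReal.ofReal (1 / r ^ finrank ℝ E) * ∫⁻ x, f x ∂μ := by
  rw [← lintegral_map hf (measurable_const_smul r), Measure.map_addHaar_smul μ hr.ne',
    lintegral_smul_measure, abs_of_pos (inv_pos.2 (pow_pos hr _)), one_div, smul_eq_mul]

theorem tsum_lattice_eq (f : (Fin (1 + e + 1) → ℝ) → ℝ≥0∞) (x : LatticeSpace (1 + e + 1)) :
    ∑' v : x.lattice, f v =
      f 0 + ∑' m : ℕ, ∫⁻ v, f (((m + 1 : ℕ) : ℝ) • v 0) ∂primitiveKernel 1 e x := by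
  obtain ⟨g, rfl⟩ := toLattice_surjective x
  calc ∑' v : matrixLattice g, f v
      = ∑' z, f (latticeMap g z) := ((latticeEquiv g).toEquiv.tsum_eq fun v => f v).symm
    _ = f 0 + ∑' z : ({0}ᶜ : Set (Fin (1 + e + 1) → ℤ)), f (latticeMap g z) := by
        rw [← ENNReal.summable.tsum_add_tsum_compl (s := {0}) ENNReal.summable,
          tsum_singleton 0 fun z => f (latticeMap g z), map_zero]
    _ = f 0 + ∑' p : ℕ × primInt 1 e, f (latticeMap g (smulPrimInt p)) := by
        rw [← range_smulPrimInt, tsum_range (fun z => f (latticeMap g z)) smulPrimInt_injective]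
    _ = _ := by
        rw [ENNReal.tsum_prod']
        refine congrArg (f 0 + ·) (tsum_congr fun m => ?_)
        rw [lintegral_primitiveKernel]
        refine tsum_congr fun u => congrArg f ?_
        rw [smulPrimInt, map_smul, applyInt_eq_latticeMap, ← Int.cast_smul_eq_zsmul ℝ,
          Int.cast_natCast]

variable {μ : Measure (LatticeSpace (1 + e + 1))}

theorem measurable_tsum_lattice {f : (Fin (1 + e + 1) → ℝ) → ℝ≥0∞} (hf : Measurable f) :
    Measurable fun x : LatticeSpace (1 + e + 1) => ∑' v : x.lattice, f v := by
  simp only [tsum_lattice_eq]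
  exact measurable_const.add <| Measurable.tsum fun m =>
    Measurable.lintegral_kernel (hf.comp (by fun_prop))

theorem lintegral_tsum_lattice (hμ : IsNormalizedHaar μ) {f : (Fin (1 + e + 1) → ℝ) → ℝ≥0∞}
    (hf : Measurable f) :
    ∫⁻ x, ∑' v : x.lattice, f v ∂μ = f 0 + meanConst 1 e * zetaSum (1 + e + 1) * ∫⁻ v, f v := by
  have := hμ.isProbabilityMeasure
  have hfm (m : ℕ) : Measurable fun v : Fin (1 + e + 1) → ℝ => f (((m + 1 : ℕ) : ℝ) • v) :=
    hf.comp (measurable_const_smul _)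
  have hfm' (m : ℕ) : Measurable fun v : Fin 1 → Fin (1 + e + 1) → ℝ =>
    f (((m + 1 : ℕ) : ℝ) • v 0) := (hfm m).comp (measurable_pi_apply 0)
  have hterm (m : ℕ) : ∫⁻ x, ∫⁻ v, f (((m + 1 : ℕ) : ℝ) • v 0) ∂primitiveKernel 1 e x ∂μ =
      meanConst 1 e * (ENNReal.ofReal (1 / ((m + 1 : ℕ) : ℝ) ^ (1 + e + 1)) * ∫⁻ v, f v) := by
    rw [← Measure.lintegral_bind (by fun_prop) (hfm' m).aemeasurable, hμ.primitiveKernel_comp,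
      lintegral_smul_measure, smul_eq_mul]
    refine congrArg (meanConst 1 e * ·) <| ((volume_preserving_funUnique (Fin 1)
      (Fin (1 + e + 1) → ℝ)).lintegral_comp (hfm m)).trans ?_
    rw [lintegral_comp_smul _ hf (Nat.cast_pos.2 m.succ_pos), finrank_fin_fun]
  simp only [tsum_lattice_eq]
  rw [lintegral_add_left measurable_const, lintegral_const, measure_univ, mul_one,
    lintegral_tsum fun m => (hfm' m).lintegral_kernel.aemeasurable]
  simp only [hterm]
  rw [ENNReal.tsum_mul_left, ENNReal.tsum_mul_right, zetaSum, mul_assoc]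

end SiegelFormula

section ZetaConstant

open Filter
open scoped Topology

variable {e : ℕ} {μ : Measure (LatticeSpace (1 + e + 1))}

theorem measurable_cubeCount_lattice (R : ℝ) :
    Measurable fun x : LatticeSpace (1 + e + 1) => cubeCount x.lattice R := by
  simp only [← tsum_indicator_closedBall]
  exact measurable_tsum_lattice (measurable_one.indicator Metric.isClosed_closedBall.measurableSet)

theorem lintegral_cubeCount (hμ : IsNormalizedHaar μ) (n : ℕ) :
    ∫⁻ x, cubeCount x.lattice n ∂μ =
      1 + meanConst 1 e * zetaSum (1 + e + 1) * (2 * n) ^ (1 + e + 1) := by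
  have hball : MeasurableSet (Metric.closedBall (0 : Fin (1 + e + 1) → ℝ) n) :=
    Metric.isClosed_closedBall.measurableSet
  simp only [← tsum_indicator_closedBall]
  rw [lintegral_tsum_lattice hμ (measurable_one.indicator hball), lintegral_indicator_one hball,
    indicator_of_mem (Metric.mem_closedBall_self n.cast_nonneg), Pi.one_apply,
    Real.volume_pi_closedBall _ n.cast_nonneg, Fintype.card_fin, ENNReal.ofReal_pow (by positivity),
    ENNReal.ofReal_mul zero_le_two, ENNReal.ofReal_ofNat, ENNReal.ofReal_natCast]

theorem cubeCount_div_pow_le (L : Submodule ℤ (Fin (1 + e + 1) → ℝ)) {n : ℕ} (hn : 0 < n) :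
    cubeCount L n / (n : ℝ≥0∞) ^ (1 + e + 1) ≤ 3 ^ (1 + e + 1) * cubeCount L 1 := by
  refine ENNReal.div_le_of_le_mul ((cubeCount_natCast_le L n).trans ?_)
  rw [Fintype.card_fin, mul_right_comm, ← mul_pow]
  gcongr
  exact_mod_cast (by omega : 2 * n + 1 ≤ 3 * n)

theorem meanConst_ne_top (d e : ℕ) : meanConst d e ≠ ∞ :=
  ENNReal.div_ne_top (slCovolume_ne_top e) (slCovolume_ne_zero _)

theorem meanConst_mul_zetaSum_ne_top : meanConst 1 e * zetaSum (1 + e + 1) ≠ ∞ :=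
  ENNReal.mul_ne_top (meanConst_ne_top 1 e) (zetaSum_ne_top (by omega))

theorem tendsto_lintegral_cubeCount_div_pow (hμ : IsNormalizedHaar μ) :
    Tendsto (fun n : ℕ => ∫⁻ x, cubeCount x.lattice n / (n : ℝ≥0∞) ^ (1 + e + 1) ∂μ) atTop
      (𝓝 (2 ^ (1 + e + 1))) := by
  have := hμ.isProbabilityMeasure
  have hbound : ∫⁻ x, 3 ^ (1 + e + 1) * cubeCount x.lattice 1 ∂μ ≠ ∞ := by
    have hone := lintegral_cubeCount hμ 1
    rw [Nat.cast_one, Nat.cast_one, mul_one] at hone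
    rw [lintegral_const_mul _ (measurable_cubeCount_lattice 1), hone]
    have := meanConst_mul_zetaSum_ne_top (e := e)
    finiteness
  have hdom : ∀ᶠ n : ℕ in atTop, ∀ᵐ x ∂μ, cubeCount x.lattice n / (n : ℝ≥0∞) ^ (1 + e + 1) ≤
      3 ^ (1 + e + 1) * cubeCount x.lattice 1 :=
    (eventually_gt_atTop 0).mono fun n hn => .of_forall fun x => cubeCount_div_pow_le x.lattice hn
  have hlim : ∀ᵐ x ∂μ, Tendsto (fun n : ℕ => cubeCount x.lattice n / (n : ℝ≥0∞) ^ (1 + e + 1))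
      atTop (𝓝 (2 ^ (1 + e + 1))) := .of_forall fun x => by
    obtain ⟨g, rfl⟩ := toLattice_surjective x
    have h := tendsto_cubeCount_div_pow (matrixLattice g) (covolume_matrixLattice g)
    rwa [Fintype.card_fin] at h
  have hmeas : ∀ᶠ n : ℕ in atTop, Measurable fun x : LatticeSpace (1 + e + 1) =>
      cubeCount x.lattice n / (n : ℝ≥0∞) ^ (1 + e + 1) :=
    .of_forall fun n => (measurable_cubeCount_lattice n).div_const _
  have h := tendsto_lintegral_filter_of_dominated_convergence _ hmeas hdom hbound hlim
  rwa [lintegral_const, measure_univ, mul_one] at h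

theorem tendsto_one_add_mul_pow_div_pow (C : ℝ≥0∞) {k : ℕ} (hk : k ≠ 0) :
    Tendsto (fun n : ℕ => (1 + C * (2 * n) ^ k) / (n : ℝ≥0∞) ^ k) atTop (𝓝 (C * 2 ^ k)) := by
  have hinv : Tendsto (fun n : ℕ => ((n : ℝ≥0∞) ^ k)⁻¹ + C * 2 ^ k) atTop (𝓝 (C * 2 ^ k)) := by
    have := ((ENNReal.continuous_pow k).tendsto 0).comp ENNReal.tendsto_inv_nat_nhds_zero
    rw [zero_pow hk] at this
    simpa only [Function.comp_def, ENNReal.inv_pow, zero_add] using this.add_const (C * 2 ^ k)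
  refine hinv.congr' ?_
  filter_upwards [eventually_gt_atTop 0] with n hn
  have hn0 : (n : ℝ≥0∞) ^ k ≠ 0 := pow_ne_zero _ (Nat.cast_ne_zero.2 hn.ne')
  rw [ENNReal.add_div, one_div, mul_pow, ← mul_assoc,
    ENNReal.mul_div_cancel_right hn0 (by finiteness)]

/-- The mean number of lattice points in a large cube is asymptotic to the volume of the cube,
as it is for every single unimodular lattice. -/
theorem meanConst_mul_zetaSum (e : ℕ) : meanConst 1 e * zetaSum (1 + e + 1) = 1 := by
  obtain ⟨μ, hμ⟩ := exists_isNormalizedHaar (slCovolume_ne_top (1 + e))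
  have hlim := tendsto_one_add_mul_pow_div_pow (meanConst 1 e * zetaSum (1 + e + 1))
    (1 + e).succ_ne_zero
  have hlim' := tendsto_lintegral_cubeCount_div_pow hμ
  simp only [div_eq_mul_inv, lintegral_mul_const _ (measurable_cubeCount_lattice _),
    lintegral_cubeCount hμ] at hlim hlim'
  exact (ENNReal.mul_eq_right (by positivity) (by finiteness)).1 (tendsto_nhds_unique hlim hlim')

theorem slCovolume_succ (e : ℕ) :
    slCovolume (Fin.last (1 + e)) = zetaSum (1 + e + 1) * slCovolume (Fin.last e) := by
  have h := meanConst_mul_zetaSum e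
  rw [meanConst, div_eq_mul_inv, mul_right_comm, ← div_eq_mul_inv,
    ENNReal.div_eq_one_iff (slCovolume_ne_zero _) (slCovolume_ne_top _)] at h
  rw [← h, mul_comm]

theorem slCovolume_add (d e : ℕ) : slCovolume (Fin.last (d + e)) =
    (∏ i ∈ Finset.range d, zetaSum (d + e + 1 - i)) * slCovolume (Fin.last e) := by
  induction d with
  | zero => rw [Finset.range_zero, Finset.prod_empty, one_mul, Nat.zero_add]
  | succ d ih =>
    rw [show d + 1 + e = 1 + (d + e) by omega, slCovolume_succ, ih, Finset.prod_range_succ',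
      mul_comm _ (zetaSum _), mul_assoc, Nat.sub_zero]
    simp only [show ∀ i, 1 + (d + e) + 1 - (i + 1) = d + e + 1 - i by omega]

theorem meanConst_eq (d e : ℕ) :
    meanConst d e = (∏ i ∈ Finset.range d, zetaSum (d + e + 1 - i))⁻¹ := by
  have h0 : slCovolume (Fin.last e) ≠ 0 := slCovolume_ne_zero _
  have ht : slCovolume (Fin.last e) ≠ ∞ := slCovolume_ne_top _
  rw [meanConst, slCovolume_add, div_eq_mul_inv, ENNReal.mul_inv (Or.inr ht) (Or.inr h0),
    mul_left_comm, ENNReal.mul_inv_cancel h0 ht, mul_one]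

theorem toReal_meanConst (d e : ℕ) : ((meanConst d e).toReal : ℂ) =
    1 / ∏ i ∈ Finset.range d, riemannZeta (((d + e + 1 : ℕ) : ℂ) - (i : ℂ)) := by
  have hzeta : ∏ i ∈ Finset.range d, riemannZeta (((d + e + 1 : ℕ) : ℂ) - (i : ℂ)) =
      ∏ i ∈ Finset.range d, ((zetaSum (d + e + 1 - i)).toReal : ℂ) := by
    refine Finset.prod_congr rfl fun i hi => ?_
    have hid := Finset.mem_range.1 hi
    rw [← riemannZeta_eq_zetaSum (by omega), Nat.cast_sub (by omega)]
  rw [hzeta, meanConst_eq, ENNReal.toReal_inv, ENNReal.toReal_prod, one_div]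
  push_cast
  rfl

end ZetaConstant

section MeanValue

open ProbabilityTheory

variable {d e : ℕ} {μ : Measure (LatticeSpace (d + e + 1))} {E : Type*} [NormedAddCommGroup E]
  {φ : (Fin d → Fin (d + e + 1) → ℝ) → E}

theorem summable_norm_of_integrable_primitiveKernel {x : LatticeSpace (d + e + 1)}
    (hφ : Integrable φ (primitiveKernel d e x)) :
    Summable fun v : primitiveTuples d x.lattice => ‖φ v‖ := by
  rw [← tsum_enorm_ne_top_iff_summable_norm,
    ← lintegral_restrict_count (countable_primitiveTuples x) fun v => ‖φ v‖ₑ]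
  exact hφ.2.ne

theorem IsNormalizedHaar.integrable_primitiveKernel_comp (hμ : IsNormalizedHaar μ)
    (hφ : Integrable φ) : Integrable φ (primitiveKernel d e ∘ₘ μ) := by
  rw [hμ.primitiveKernel_comp]
  exact hφ.smul_measure (meanConst_ne_top d e)

variable [NormedSpace ℝ E]

theorem integral_primitiveKernel [CompleteSpace E] {x : LatticeSpace (d + e + 1)}
    (hφ : Integrable φ (primitiveKernel d e x)) :
    ∫ v, φ v ∂primitiveKernel d e x = ∑' v : primitiveTuples d x.lattice, φ v := by
  rw [primitiveKernel_apply, setIntegral_countable φ (countable_primitiveTuples x) hφ]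
  simp only [Measure.real, Measure.count_singleton, ENNReal.toReal_one, one_smul]

theorem IsNormalizedHaar.integrable_integral_primitiveKernel (hμ : IsNormalizedHaar μ)
    (hφ : Integrable φ) : Integrable (fun x => ∫ v, φ v ∂primitiveKernel d e x) μ := by
  have h := hμ.integrable_primitiveKernel_comp hφ
  rw [Measure.comp_eq_comp_const_apply] at h
  exact h.integral_comp

theorem IsNormalizedHaar.integral_integral_primitiveKernel (hμ : IsNormalizedHaar μ)
    (hφ : Integrable φ) :
    ∫ x, ∫ v, φ v ∂primitiveKernel d e x ∂μ = (meanConst d e).toReal • ∫ v, φ v := by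
  have h := hμ.integrable_primitiveKernel_comp hφ
  rw [Measure.comp_eq_comp_const_apply] at h
  rw [← integral_smul_measure, ← hμ.primitiveKernel_comp, Measure.comp_eq_comp_const_apply,
    Kernel.integral_comp h, Kernel.const_apply]

end MeanValue

end

theorem theorem7p3 (k d : ℕ) (hd : 1 ≤ d) (hdk : d < k) :
    (∃ μ : Measure (LatticeSpace k), IsNormalizedHaar μ) ∧
    ∀ μ : Measure (LatticeSpace k), IsNormalizedHaar μ →
      ∀ φ : (Fin d → Fin k → ℝ) → ℂ, Integrable φ volume →
        (∀ᵐ x ∂μ, Summable fun v : primitiveTuples d x.lattice => φ v) ∧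
        Integrable (primitiveSum φ) μ ∧
        ∫ x, primitiveSum φ x ∂μ =
          (1 / ∏ i ∈ Finset.range d, riemannZeta ((k : ℂ) - (i : ℂ))) * ∫ v, φ v := by
  obtain ⟨e, rfl⟩ := Nat.exists_eq_add_of_lt hdk
  refine ⟨exists_isNormalizedHaar (slCovolume_ne_top (d + e)), fun μ hμ φ hφ => ?_⟩
  have hint : ∀ᵐ x ∂μ, Integrable φ (primitiveKernel d e x) :=
    Measure.ae_integrable_of_integrable_comp (hμ.integrable_primitiveKernel_comp hφ)
  have hsum : primitiveSum φ =ᵐ[μ] fun x => ∫ v, φ v ∂primitiveKernel d e x :=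
    hint.mono fun x hx => (integral_primitiveKernel hx).symm
  refine ⟨hint.mono fun x hx => (summable_norm_of_integrable_primitiveKernel hx).of_norm,
    (hμ.integrable_integral_primitiveKernel hφ).congr hsum.symm, ?_⟩
  rw [integral_congr_ae hsum, hμ.integral_integral_primitiveKernel hφ, Complex.real_smul,
    toReal_meanConst]
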